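/- **Theorem.** Let $\theta\in\mathbb R$ and $\lambda=e^{2\pi i\theta}$. All $C^*$-algebras and $*$-homomorphisms below are unital. Let - $\mathcal A_\theta^{\mathrm{free}}$ (the *free twist of two isometries*) be the universal $C^*$-algebra generated by two isometries $u,v$ (that is, $u^*u=1=v^*v$) with $uv=\lambda vu$; - $\mathcal T$ be the Toeplitz algebra, i.e. the universal $C^*$-algebra generated by an isometry $v$, and let $\mathcal T\rtimes_\theta\mathbb Z$ be its crossed product by the automorphism $v\mapsto\lambda v$, i.e. the universal $C^*$-algebra generated by $\mathcal T$ and a unitary $u$ with $uau^*=\alpha(a)$ for $a\in\mathcal T$, where $\alpha$ is that automorphism (so that $uv=\lambda vu$); - $C(S^1)*_{\mathbb C}\mathbb C^2$ be the unital (full) free product, with $\bar u$ the image of the identity function $z\mapsto z$ of $S^1$ (a unitary) and $\bar p$ the image of $(1,0)\in\mathbb C^2$ (a projection). Denote by $A\otimes B$ the (maximal) $C^*$-tensor product, i.e. the universal $C^*$-algebra generated by $A$ and $B$ (with common unit) subject to $ab=ba$ for all $a\in A$, $b\in B$. Then there is an injective unital $*$-homomorphism $$\iota:\mathcal A_\theta^{\mathrm{free}}\hookrightarrow(\mathcal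 T\rtimes_\theta\mathbb Z)\otimes(C(S^1)*_{\mathbb C}\mathbb C^2)$$ such that $$\iota(u)=vu\otimes\bar u\bar p+u\otimes\bar u(1-\bar p),\qquad \iota(v)=u^*v\otimes(1-\bar p)\bar u^*+u^*\otimes\bar p\bar u^*.$$ -/

import Mathlib

noncomputable section

universe u w

/-! ### C*-seminorms and the C*-algebra obtained by separation and completion -/

/-- A C*-seminorm on a complex *-algebra: a seminorm `p` with `p (xy) ≤ p x * p y` and
`p (x* x) = p x ^ 2`. -/
structure CStarSeminorm (P : Type u) [Ring P] [Algebra ℂ P] [StarRing P]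
    extends Seminorm ℂ P where
  mul_le' : ∀ x y, toFun (x * y) ≤ toFun x * toFun y
  star_mul_self' : ∀ x, toFun (star x * x) = toFun x ^ 2

namespace CStarSeminorm

variable {P : Type u} [Ring P] [Algebra ℂ P] [StarRing P]

instance : CoeFun (CStarSeminorm P) (fun _ => P → ℝ) := ⟨fun p => p.toFun⟩

theorem nonneg (p : CStarSeminorm P) (x : P) : 0 ≤ p x := apply_nonneg p.toSeminorm x

theorem zero (p : CStarSeminorm P) : p 0 = 0 := map_zero p.toSeminorm

theorem add_le (p : CStarSeminorm P) (x y : P) : p (x + y) ≤ p x + p y :=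
  p.toSeminorm.add_le' x y

theorem smul (p : CStarSeminorm P) (c : ℂ) (x : P) : p (c • x) = ‖c‖ * p x :=
  p.toSeminorm.smul' c x

theorem mul_le (p : CStarSeminorm P) (x y : P) : p (x * y) ≤ p x * p y := p.mul_le' x y

theorem star_mul_self (p : CStarSeminorm P) (x : P) : p (star x * x) = p x ^ 2 :=
  p.star_mul_self' x

theorem one_le_one (p : CStarSeminorm P) : p 1 ≤ 1 := by
  have h := p.star_mul_self 1
  simp only [star_one, mul_one] at h
  nlinarith [p.nonneg 1]

theorem le_star (p : CStarSeminorm P) (x : P) : p x ≤ p (star x) := by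
  have h1 := p.star_mul_self x
  have h2 := p.mul_le (star x) x
  have h3 := p.nonneg x
  have h4 := p.nonneg (star x)
  by_contra! h
  nlinarith

theorem star_eq (p : CStarSeminorm P) (x : P) : p (star x) = p x :=
  le_antisymm (by simpa using p.le_star (star x)) (p.le_star x)

/-- If `p (x* x - 1) = 0` then `p x ≤ 1`. -/
theorem le_one_of_isometry (p : CStarSeminorm P) (x : P) (h : p (star x * x - 1) = 0) :
    p x ≤ 1 := by
  have h1 := p.star_mul_self x
  have h2 := p.add_le (star x * x - 1) 1
  rw [sub_add_cancel, h, h1] at h2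
  nlinarith [p.one_le_one, p.nonneg x]

/-- A copy of `P`, carrying the seminorm `p`. -/
def Pre (_p : CStarSeminorm P) : Type u := P

variable (p : CStarSeminorm P)

instance : Ring p.Pre := inferInstanceAs (Ring P)
instance : Algebra ℂ p.Pre := inferInstanceAs (Algebra ℂ P)
instance : StarRing p.Pre := inferInstanceAs (StarRing P)
instance [StarModule ℂ P] : StarModule ℂ p.Pre := inferInstanceAs (StarModule ℂ P)

instance : SeminormedRing p.Pre where
  __ := (inferInstance : Ring p.Pre)
  __ := (AddGroupSeminorm.toSeminormedAddCommGroup (E := P) p.toAddGroupSeminorm)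
  norm_mul_le := p.mul_le

theorem norm_pre (x : p.Pre) : ‖x‖ = p x := rfl

instance : NormedSpace ℂ p.Pre where
  norm_smul_le c x := (p.smul c x).le

instance : NormedStarGroup p.Pre where
  norm_star_le x := (p.star_eq x).le

/-- The quotient of `P` by the null space of `p`, completed with respect to `p`. (Mathlib's
completion of a seminormed space separates points.) -/
abbrev Completed : Type u := UniformSpace.Completion p.Pre

/-- The canonical map to the separated completion. -/
def of (x : P) : p.Completed := UniformSpace.Completion.coe' (α := p.Pre) x

open UniformSpace

theorem starIsometry : Isometry (star : p.Pre → p.Pre) :=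
  AddMonoidHomClass.isometry_of_norm (starAddEquiv : p.Pre ≃+ p.Pre) fun x => p.star_eq x

theorem uniformContinuous_star_pre : UniformContinuous (star : p.Pre → p.Pre) :=
  (starIsometry p).uniformContinuous

instance : Star p.Completed where
  star := Completion.map (star : p.Pre → p.Pre)

theorem star_coe (x : p.Pre) : star (x : p.Completed) = ((star x : p.Pre) : p.Completed) :=
  Completion.map_coe p.uniformContinuous_star_pre x

theorem continuous_star_completed : Continuous (star : p.Completed → p.Completed) :=
  Completion.continuous_map

instance : StarRing p.Completed where
  star_involutive x := by
    induction x using Completion.induction_on with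
    | hp => exact isClosed_eq (p.continuous_star_completed.comp p.continuous_star_completed)
              continuous_id
    | ih a => simp only [star_coe, star_star]
  star_mul x y := by
    induction x, y using Completion.induction_on₂ with
    | hp =>
      refine isClosed_eq (p.continuous_star_completed.comp (by fun_prop)) ?_
      exact (p.continuous_star_completed.comp continuous_snd).mul
        (p.continuous_star_completed.comp continuous_fst)
    | ih a b => simp only [← Completion.coe_mul, star_coe, star_mul]
  star_add x y := by
    induction x, y using Completion.induction_on₂ with
    | hp =>
      refine isClosed_eq (p.continuous_star_completed.comp (by fun_prop)) ?_
      exact (p.continuous_star_completed.comp continuous_fst).add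
        (p.continuous_star_completed.comp continuous_snd)
    | ih a b => simp only [← Completion.coe_add, star_coe, star_add]

instance : CStarRing p.Completed where
  norm_mul_self_le x := by
    induction x using Completion.induction_on with
    | hp =>
      refine isClosed_le (by fun_prop) ?_
      exact ((p.continuous_star_completed).mul continuous_id).norm
    | ih a =>
      simp only [star_coe, ← Completion.coe_mul, Completion.norm_coe]
      exact ((p.star_mul_self a).trans (sq _)).ge

instance : NormedAlgebra ℂ p.Completed where
  norm_smul_le := norm_smul_le

instance [StarModule ℂ P] : StarModule ℂ p.Completed where
  star_smul c x := by
    induction x using Completion.induction_on with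
    | hp =>
      exact isClosed_eq (p.continuous_star_completed.comp (continuous_const_smul c))
        (p.continuous_star_completed.const_smul (star c))
    | ih a =>
      rw [← Completion.coe_smul, star_coe, star_coe, ← Completion.coe_smul]
      exact congrArg _ (star_smul (A := P) c a)

instance [StarModule ℂ P] : CStarAlgebra p.Completed where

/-- The canonical *-homomorphism to the separated completion. -/
def ofHom : P →⋆ₐ[ℂ] p.Completed where
  toFun := p.of
  map_one' := rfl
  map_mul' x y := Completion.coe_mul (α := p.Pre) x y
  map_zero' := rfl
  map_add' x y := Completion.coe_add (α := p.Pre) x y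
  commutes' _ := rfl
  map_star' x := (p.star_coe x).symm

theorem norm_ofHom (x : P) : ‖p.ofHom x‖ = p x := Completion.norm_coe (E := p.Pre) x

theorem denseRange_ofHom : DenseRange p.ofHom := Completion.denseRange_coe (α := p.Pre)

/-- A *-homomorphism, as a ring homomorphism on the copy of `P` which carries `p`. -/
def preHom {B : Type w} [CStarAlgebra B] (φ : P →⋆ₐ[ℂ] B) : p.Pre →+* B :=
  RingHomClass.toRingHom (φ : P →⋆ₐ[ℂ] B)

/-- A *-homomorphism dominated by `p` extends to the separated completion. -/
def extend [StarModule ℂ P] {B : Type w} [CStarAlgebra B] (φ : P →⋆ₐ[ℂ] B)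
    (h : ∀ x, ‖φ x‖ ≤ p x) : p.Completed →⋆ₐ[ℂ] B :=
  let f : p.Pre →+* B := p.preHom φ
  have hf : Continuous f :=
    AddMonoidHomClass.continuous_of_bound f 1 (fun x => by rw [one_mul]; exact h x)
  { Completion.extensionHom f hf with
    commutes' := fun c => by
      have := Completion.extensionHom_coe f hf (algebraMap ℂ p.Pre c)
      exact this.trans (φ.toAlgHom.commutes c)
    map_star' := fun x => by
      change Completion.extensionHom f hf (star x) = star (Completion.extensionHom f hf x)
      have hc : Continuous (Completion.extensionHom f hf) := Completion.continuous_extension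
      induction x using Completion.induction_on with
      | hp => exact isClosed_eq (hc.comp p.continuous_star_completed) hc.star
      | ih a =>
        rw [star_coe, Completion.extensionHom_coe, Completion.extensionHom_coe]
        exact map_star φ a }

theorem extend_ofHom [StarModule ℂ P] {B : Type w} [CStarAlgebra B] (φ : P →⋆ₐ[ℂ] B)
    (h : ∀ x, ‖φ x‖ ≤ p x) (x : P) : p.extend φ h (p.ofHom x) = φ x :=
  Completion.extensionHom_coe (α := p.Pre) (p.preHom φ)
    (AddMonoidHomClass.continuous_of_bound (p.preHom φ) 1
      (fun x => by rw [one_mul]; exact h x)) x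

/-- The zero seminorm. -/
instance : Inhabited (CStarSeminorm P) :=
  ⟨{ (0 : Seminorm ℂ P) with
      mul_le' := fun _ _ => (mul_zero (0 : ℝ)).ge
      star_mul_self' := fun _ => (zero_pow (M₀ := ℝ) two_ne_zero).symm }⟩

end CStarSeminorm

/-! ### The free unital *-algebra -/

/-- Noncommutative polynomials (with constant terms) in the generators `x_g` (`Sum.inl g`) and
their adjoints (`Sum.inr g`), for `g : G`. -/
def NCPoly (G : Type u) : Type u := FreeAlgebra ℂ (G ⊕ G)

namespace NCPoly

variable {G : Type u}

instance : Ring (NCPoly G) := inferInstanceAs (Ring (FreeAlgebra ℂ (G ⊕ G)))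
instance : Algebra ℂ (NCPoly G) := inferInstanceAs (Algebra ℂ (FreeAlgebra ℂ (G ⊕ G)))

/-- The letters: `x_g` for `Sum.inl g`, and its formal adjoint for `Sum.inr g`. -/
def var (i : G ⊕ G) : NCPoly G := FreeAlgebra.ι ℂ i

/-- The generator `x_g`. -/
def X (g : G) : NCPoly G := var (Sum.inl g)

/-- The involution: the conjugate linear ring antihomomorphism which exchanges each generator
with its formal adjoint. -/
def starAux : NCPoly G →+* (NCPoly G)ᵐᵒᵖ :=
  letI : Algebra ℂ (NCPoly G)ᵐᵒᵖ := Algebra.compHom (NCPoly G)ᵐᵒᵖ (starRingEnd ℂ)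
  RingHomClass.toRingHom (FreeAlgebra.lift ℂ (fun i : G ⊕ G => MulOpposite.op (var i.swap)) :
    FreeAlgebra ℂ (G ⊕ G) →ₐ[ℂ] (NCPoly G)ᵐᵒᵖ)

theorem starAux_var (i : G ⊕ G) :
    starAux (var i) = MulOpposite.op (var i.swap) := by
  let _ : Algebra ℂ (NCPoly G)ᵐᵒᵖ := Algebra.compHom (NCPoly G)ᵐᵒᵖ (starRingEnd ℂ)
  exact FreeAlgebra.lift_ι_apply (fun i : G ⊕ G => MulOpposite.op (var i.swap)) i

theorem starAux_algebraMap (c : ℂ) :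
    starAux (algebraMap ℂ (NCPoly G) c) =
      MulOpposite.op (algebraMap ℂ (NCPoly G) (starRingEnd ℂ c)) := by
  let _ : Algebra ℂ (NCPoly G)ᵐᵒᵖ := Algebra.compHom (NCPoly G)ᵐᵒᵖ (starRingEnd ℂ)
  exact AlgHom.commutes (FreeAlgebra.lift ℂ (fun i : G ⊕ G => MulOpposite.op (var i.swap)) :
    FreeAlgebra ℂ (G ⊕ G) →ₐ[ℂ] (NCPoly G)ᵐᵒᵖ) c

theorem induction {motive : NCPoly G → Prop}
    (algebraMap : ∀ c, motive (algebraMap ℂ (NCPoly G) c))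
    (var : ∀ i : G ⊕ G, motive (NCPoly.var i))
    (mul : ∀ a b, motive a → motive b → motive (a * b))
    (add : ∀ a b, motive a → motive b → motive (a + b)) (x : NCPoly G) : motive x :=
  FreeAlgebra.induction ℂ (G ⊕ G) (motive := motive) algebraMap var mul add x

instance : Star (NCPoly G) where
  star x := MulOpposite.unop (starAux x)

theorem star_def (x : NCPoly G) : star x = MulOpposite.unop (starAux x) := rfl

theorem star_var (i : G ⊕ G) :
    star (var i) = var i.swap := by
  rw [star_def, starAux_var, MulOpposite.unop_op]

theorem star_algebraMap' (c : ℂ) :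
    star (algebraMap ℂ (NCPoly G) c) = algebraMap ℂ (NCPoly G) (starRingEnd ℂ c) := by
  rw [star_def, starAux_algebraMap, MulOpposite.unop_op]

instance : StarRing (NCPoly G) where
  star_mul x y := by simp only [star_def, map_mul, MulOpposite.unop_mul]
  star_add x y := by simp only [star_def, map_add, MulOpposite.unop_add]
  star_involutive x := by
    have hmul : ∀ a b : NCPoly G, star (a * b) = star b * star a := fun a b => by
      simp only [star_def, map_mul, MulOpposite.unop_mul]
    have hadd : ∀ a b : NCPoly G, star (a + b) = star a + star b := fun a b => by
      simp only [star_def, map_add, MulOpposite.unop_add]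
    induction x using NCPoly.induction with
    | algebraMap c => rw [star_algebraMap', star_algebraMap', Complex.conj_conj]
    | var i => rw [star_var, star_var, Sum.swap_swap]
    | mul a b ha hb => rw [hmul, hmul, ha, hb]
    | add a b ha hb => rw [hadd, hadd, ha, hb]

instance : StarModule ℂ (NCPoly G) where
  star_smul c x := by
    rw [Algebra.smul_def, star_mul, star_algebraMap', ← Algebra.commutes, ← Algebra.smul_def]
    rfl

/-- Evaluation of a noncommutative *-polynomial at a family of elements of a *-algebra. -/
def eval {B : Type w} [Ring B] [Algebra ℂ B] [StarRing B] [StarModule ℂ B] (y : G → B) :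
    NCPoly G →⋆ₐ[ℂ] B :=
  { (FreeAlgebra.lift ℂ (Sum.elim y (fun g => star (y g))) : FreeAlgebra ℂ (G ⊕ G) →ₐ[ℂ] B) with
    map_star' := fun x => by
      set f : NCPoly G →ₐ[ℂ] B :=
        (FreeAlgebra.lift ℂ (Sum.elim y (fun g => star (y g))) : FreeAlgebra ℂ (G ⊕ G) →ₐ[ℂ] B)
        with hf
      have hι : ∀ i : G ⊕ G, f (var i) =
          Sum.elim y (fun g => star (y g)) i := fun i => FreeAlgebra.lift_ι_apply _ i
      change f (star x) = star (f x)
      induction x using NCPoly.induction with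
      | algebraMap c =>
        rw [star_algebraMap', AlgHom.commutes, AlgHom.commutes]
        exact algebraMap_star_comm c
      | var i =>
        rw [star_var, hι, hι]
        cases i <;> simp
      | mul a b ha hb => rw [star_mul, map_mul, map_mul, star_mul, ha, hb]
      | add a b ha hb => rw [star_add, map_add, map_add, star_add, ha, hb] }

theorem eval_X {B : Type w} [Ring B] [Algebra ℂ B] [StarRing B] [StarModule ℂ B] (y : G → B)
    (g : G) : eval y (X g) = y g :=
  FreeAlgebra.lift_ι_apply (Sum.elim y (fun g => star (y g))) (Sum.inl g)

theorem hom_ext {B : Type w} [Ring B] [Algebra ℂ B] [StarRing B] [StarModule ℂ B]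
    {φ ψ : NCPoly G →⋆ₐ[ℂ] B} (h : ∀ g, φ (X g) = ψ (X g)) : φ = ψ := by
  ext x
  induction x using NCPoly.induction with
  | algebraMap c => exact (φ.toAlgHom.commutes c).trans (ψ.toAlgHom.commutes c).symm
  | var i =>
    cases i with
    | inl g => exact h g
    | inr g =>
      have : NCPoly.var (Sum.inr g) = star (X g) :=
        (star_var (Sum.inl g)).symm
      rw [this, map_star, map_star, h g]
  | mul a b ha hb => rw [map_mul, map_mul, ha, hb]
  | add a b ha hb => rw [map_add, map_add, ha, hb]

end NCPoly

/-! ### Universal unital C*-algebras given by generators and relations -/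

/-- Generators `G` and relations `r = 0` (`r ∈ rel`) for which the supremum of all C*-seminorms
compatible with the relations is finite on every generator (hence on every polynomial). -/
structure CStarPresentation (G : Type u) where
  rel : Set (NCPoly G)
  bounded : ∀ g : G, ∃ M : ℝ, ∀ p : CStarSeminorm (NCPoly G),
    (∀ r ∈ rel, p r = 0) → p (NCPoly.X g) ≤ M

namespace CStarPresentation

variable {G : Type u} (R : CStarPresentation G)

/-- The C*-seminorms on the universal *-algebra with generators `G` and relations `R`, viewed as
C*-seminorms on polynomials. -/
abbrev Seminorms : Type u := { p : CStarSeminorm (NCPoly G) // ∀ r ∈ R.rel, p r = 0 }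

instance : Nonempty R.Seminorms := ⟨⟨default, fun _ _ => rfl⟩⟩

theorem bddAbove (x : NCPoly G) : BddAbove (Set.range fun p : R.Seminorms => p.1 x) := by
  suffices h : ∃ M : ℝ, ∀ p : R.Seminorms, p.1 x ≤ M by
    obtain ⟨M, hM⟩ := h
    exact ⟨M, by rintro _ ⟨p, rfl⟩; exact hM p⟩
  induction x using NCPoly.induction with
  | algebraMap c =>
    refine ⟨‖c‖, fun p => ?_⟩
    rw [Algebra.algebraMap_eq_smul_one, p.1.smul]
    exact mul_le_of_le_one_right (norm_nonneg c) p.1.one_le_one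
  | var i =>
    cases i with
    | inl g =>
      obtain ⟨M, hM⟩ := R.bounded g
      exact ⟨M, fun p => hM p.1 p.2⟩
    | inr g =>
      obtain ⟨M, hM⟩ := R.bounded g
      refine ⟨M, fun p => ?_⟩
      have : NCPoly.var (Sum.inr g) = star (NCPoly.X g) :=
        (NCPoly.star_var (Sum.inl g)).symm
      rw [this, p.1.star_eq]
      exact hM p.1 p.2
  | mul a b ha hb =>
    obtain ⟨M, hM⟩ := ha
    obtain ⟨N, hN⟩ := hb
    refine ⟨M * N, fun p => (p.1.mul_le a b).trans ?_⟩
    exact mul_le_mul (hM p) (hN p) (p.1.nonneg b) ((p.1.nonneg a).trans (hM p))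
  | add a b ha hb =>
    obtain ⟨M, hM⟩ := ha
    obtain ⟨N, hN⟩ := hb
    exact ⟨M + N, fun p => (p.1.add_le a b).trans (add_le_add (hM p) (hN p))⟩

theorem le_iSup (p : R.Seminorms) (x : NCPoly G) : p.1 x ≤ ⨆ q : R.Seminorms, q.1 x :=
  le_ciSup (R.bddAbove x) p

theorem iSup_nonneg (x : NCPoly G) : 0 ≤ ⨆ q : R.Seminorms, q.1 x :=
  Real.iSup_nonneg fun q => q.1.nonneg x

/-- The largest C*-seminorm compatible with the relations:
`‖x‖ = sup {p x | p a C*-seminorm vanishing on the relations}`. -/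
def universalSeminorm : CStarSeminorm (NCPoly G) where
  toFun x := ⨆ p : R.Seminorms, p.1 x
  map_zero' := by
    have : (fun p : R.Seminorms => p.1 (0 : NCPoly G)) = fun _ => 0 :=
      funext fun p => p.1.zero
    rw [this, ciSup_const]
  add_le' x y := ciSup_le fun p =>
    (p.1.add_le x y).trans (add_le_add (R.le_iSup p x) (R.le_iSup p y))
  neg' x := by
    congr 1
    exact funext fun p => map_neg_eq_map p.1.toSeminorm x
  smul' c x := by
    rw [Real.mul_iSup_of_nonneg (norm_nonneg c)]
    congr 1
    exact funext fun p => p.1.smul c x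
  mul_le' x y := ciSup_le fun p =>
    (p.1.mul_le x y).trans
      (mul_le_mul (R.le_iSup p x) (R.le_iSup p y) (p.1.nonneg y) (R.iSup_nonneg x))
  star_mul_self' x := by
    refine le_antisymm (ciSup_le fun p => ?_) ?_
    · rw [p.1.star_mul_self]
      exact pow_le_pow_left₀ (p.1.nonneg x) (R.le_iSup p x) 2
    · have h : (⨆ p : R.Seminorms, p.1 x) ≤ √(⨆ p : R.Seminorms, p.1 (star x * x)) :=
        ciSup_le fun p => Real.le_sqrt_of_sq_le (by
          rw [← p.1.star_mul_self]
          exact R.le_iSup p (star x * x))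
      calc (⨆ p : R.Seminorms, p.1 x) ^ 2
          ≤ √(⨆ p : R.Seminorms, p.1 (star x * x)) ^ 2 :=
            pow_le_pow_left₀ (R.iSup_nonneg x) h 2
        _ = _ := Real.sq_sqrt (R.iSup_nonneg _)

/-- The universal unital C*-algebra with the given generators and relations. -/
def Alg : Type u := R.universalSeminorm.Completed

instance : CStarAlgebra R.Alg := inferInstanceAs (CStarAlgebra R.universalSeminorm.Completed)

/-- The canonical map from polynomials to the universal C*-algebra. -/
def ofPoly : NCPoly G →⋆ₐ[ℂ] R.Alg := R.universalSeminorm.ofHom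

/-- The generators of the universal C*-algebra. -/
def gen (g : G) : R.Alg := R.ofPoly (NCPoly.X g)

theorem ofPoly_rel {r : NCPoly G} (hr : r ∈ R.rel) : R.ofPoly r = 0 := by
  rw [← norm_eq_zero]
  refine (R.universalSeminorm.norm_ofHom r).trans ?_
  change (⨆ p : R.Seminorms, p.1 r) = 0
  have : (fun p : R.Seminorms => p.1 r) = fun _ => 0 := funext fun p => p.2 r hr
  rw [this, ciSup_const]

/-- The C*-seminorm induced by a *-homomorphism to a C*-algebra. -/
def seminormOfHom {B : Type w} [CStarAlgebra B] (φ : NCPoly G →⋆ₐ[ℂ] B) :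
    CStarSeminorm (NCPoly G) where
  toFun x := ‖φ x‖
  map_zero' := by simp
  add_le' x y := by rw [map_add]; exact norm_add_le _ _
  neg' x := by rw [map_neg, norm_neg]
  smul' c x := by rw [map_smul, norm_smul]
  mul_le' x y := by rw [map_mul]; exact norm_mul_le _ _
  star_mul_self' x := by rw [map_mul, map_star, CStarRing.norm_star_mul_self, sq]

theorem norm_eval_le {B : Type w} [CStarAlgebra B] (y : G → B)
    (hy : ∀ r ∈ R.rel, NCPoly.eval y r = 0) (x : NCPoly G) :
    ‖NCPoly.eval y x‖ ≤ R.universalSeminorm x :=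
  R.le_iSup ⟨seminormOfHom (NCPoly.eval y), fun r hr => by
    change ‖NCPoly.eval y r‖ = 0
    rw [hy r hr, norm_zero]⟩ x

/-- The universal property: elements `y g` of a unital C*-algebra which satisfy the relations
define a unital *-homomorphism. -/
def lift {B : Type w} [CStarAlgebra B] (y : G → B)
    (hy : ∀ r ∈ R.rel, NCPoly.eval y r = 0) : R.Alg →⋆ₐ[ℂ] B :=
  R.universalSeminorm.extend (NCPoly.eval y) (R.norm_eval_le y hy)

theorem lift_gen {B : Type w} [CStarAlgebra B] (y : G → B)
    (hy : ∀ r ∈ R.rel, NCPoly.eval y r = 0) (g : G) : R.lift y hy (R.gen g) = y g :=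
  (R.universalSeminorm.extend_ofHom _ (R.norm_eval_le y hy) _).trans (NCPoly.eval_X y g)

theorem hom_ext {B : Type w} [CStarAlgebra B] {φ ψ : R.Alg →⋆ₐ[ℂ] B}
    (h : ∀ g, φ (R.gen g) = ψ (R.gen g)) : φ = ψ := by
  have h1 : φ.comp R.ofPoly = ψ.comp R.ofPoly := NCPoly.hom_ext h
  have hφ : Continuous φ := AddMonoidHomClass.continuous_of_bound φ 1 fun x => by
    simpa using NonUnitalStarAlgHom.norm_apply_le φ x
  have hψ : Continuous ψ := AddMonoidHomClass.continuous_of_bound ψ 1 fun x => by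
    simpa using NonUnitalStarAlgHom.norm_apply_le ψ x
  have h2 : (φ : R.Alg → B) = ψ := by
    refine DenseRange.equalizer (f := R.ofPoly) R.universalSeminorm.denseRange_ofHom hφ hψ ?_
    exact funext fun x => DFunLike.congr_fun h1 x
  exact DFunLike.coe_injective h2

end CStarPresentation

/-! ### The relations of a given C*-algebra -/

/-- The relations of the unital C*-algebra `A`, imposed on generators `x_{f a}`, `a ∈ A`. -/
inductive RelationsOf (A : Type u) [CStarAlgebra A] {G : Type w} (f : A → G) : NCPoly G → Prop
  | add (a b : A) :
      RelationsOf A f (NCPoly.X (f (a + b)) - (NCPoly.X (f a) + NCPoly.X (f b)))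
  | mul (a b : A) :
      RelationsOf A f (NCPoly.X (f (a * b)) - NCPoly.X (f a) * NCPoly.X (f b))
  | smul (c : ℂ) (a : A) :
      RelationsOf A f (NCPoly.X (f (c • a)) - c • NCPoly.X (f a))
  | star (a : A) :
      RelationsOf A f (NCPoly.X (f (star a)) - star (NCPoly.X (f a)))
  | one : RelationsOf A f (NCPoly.X (f 1) - 1)

/-- A map to a *-algebra which satisfies the relations of `A` is a unital *-homomorphism. -/
def RelationsOf.hom {A : Type u} [CStarAlgebra A] {G : Type w} {f : A → G} {B : Type*}
    [CStarAlgebra B] (φ : NCPoly G →⋆ₐ[ℂ] B) (h : ∀ r, RelationsOf A f r → φ r = 0) :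
    A →⋆ₐ[ℂ] B where
  toFun a := φ (NCPoly.X (f a))
  map_one' := by simpa [sub_eq_zero] using h _ .one
  map_mul' a b := by simpa [sub_eq_zero] using h _ (.mul a b)
  map_zero' := by simpa [sub_eq_zero] using h _ (.smul 0 0)
  map_add' a b := by simpa only [map_sub, map_add, sub_eq_zero] using h _ (.add a b)
  commutes' c := by
    have h1 := h _ (.smul c 1)
    have h2 := h _ .one
    rw [map_sub, sub_eq_zero] at h1 h2
    rw [Algebra.algebraMap_eq_smul_one, h1, map_smul, h2, map_one,
      Algebra.algebraMap_eq_smul_one]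
  map_star' a := by
    simpa only [map_sub, map_star, sub_eq_zero] using h _ (.star a)

theorem RelationsOf.le_norm {A : Type u} [CStarAlgebra A] {G : Type w} {f : A → G}
    (p : CStarSeminorm (NCPoly G)) (h : ∀ r, RelationsOf A f r → p r = 0) (a : A) :
    p (NCPoly.X (f a)) ≤ ‖a‖ := by
  have h' : ∀ r, RelationsOf A f r → p.ofHom r = 0 := fun r hr => by
    rw [← norm_eq_zero, p.norm_ofHom, h r hr]
  rw [← p.norm_ofHom]
  exact NonUnitalStarAlgHom.norm_apply_le (RelationsOf.hom p.ofHom h') a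

/-! ### Maximal tensor products, unital free products, crossed products by `ℤ` -/

/-- The relations of `A`, those of `B`, and `ab = ba` for all `a ∈ A`, `b ∈ B`. -/
def tensorPresentation (A : Type u) (B : Type w) [CStarAlgebra A] [CStarAlgebra B] :
    CStarPresentation (A ⊕ B) where
  rel := {r | RelationsOf A Sum.inl r} ∪ {r | RelationsOf B Sum.inr r} ∪
    {r | ∃ (a : A) (b : B), r = NCPoly.X (Sum.inl a) * NCPoly.X (Sum.inr b) -
      NCPoly.X (Sum.inr b) * NCPoly.X (Sum.inl a)}
  bounded := by
    rintro (a | b)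
    · exact ⟨‖a‖, fun p hp => RelationsOf.le_norm p (fun r hr => hp r (.inl (.inl hr))) a⟩
    · exact ⟨‖b‖, fun p hp => RelationsOf.le_norm p (fun r hr => hp r (.inl (.inr hr))) b⟩

/-- The (maximal) C*-tensor product of two unital C*-algebras. -/
abbrev CStarTensor (A : Type u) (B : Type w) [CStarAlgebra A] [CStarAlgebra B] : Type (max u w) :=
  (tensorPresentation A B).Alg

/-- The elementary tensor `a ⊗ b`. -/
def CStarTensor.tmul {A : Type u} {B : Type w} [CStarAlgebra A] [CStarAlgebra B] (a : A) (b : B) :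
    CStarTensor A B :=
  (tensorPresentation A B).gen (Sum.inl a) * (tensorPresentation A B).gen (Sum.inr b)

/-- The relations of `A` and those of `B`, the units being identified. -/
def freeProductPresentation (A : Type u) (B : Type w) [CStarAlgebra A] [CStarAlgebra B] :
    CStarPresentation (A ⊕ B) where
  rel := {r | RelationsOf A Sum.inl r} ∪ {r | RelationsOf B Sum.inr r}
  bounded := by
    rintro (a | b)
    · exact ⟨‖a‖, fun p hp => RelationsOf.le_norm p (fun r hr => hp r (.inl hr)) a⟩
    · exact ⟨‖b‖, fun p hp => RelationsOf.le_norm p (fun r hr => hp r (.inr hr)) b⟩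

/-- The unital (full) free product `A *_ℂ B` of two unital C*-algebras. -/
abbrev UnitalFreeProduct (A : Type u) (B : Type w) [CStarAlgebra A] [CStarAlgebra B] :
    Type (max u w) :=
  (freeProductPresentation A B).Alg

/-- The relations of `A`, the unitarity of `u`, and `u a u* = α a` for all `a ∈ A`. -/
def crossedPresentation (A : Type u) [CStarAlgebra A] (α : A ≃⋆ₐ[ℂ] A) :
    CStarPresentation (A ⊕ Unit) where
  rel := {r | RelationsOf A Sum.inl r} ∪
    {star (NCPoly.X (Sum.inr ())) * NCPoly.X (Sum.inr ()) - 1,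
      NCPoly.X (Sum.inr ()) * star (NCPoly.X (Sum.inr ())) - 1} ∪
    {r | ∃ a : A, r = NCPoly.X (Sum.inr ()) * NCPoly.X (Sum.inl a) * star (NCPoly.X (Sum.inr ())) -
      NCPoly.X (Sum.inl (α a))}
  bounded := by
    rintro (a | ⟨⟩)
    · exact ⟨‖a‖, fun p hp => RelationsOf.le_norm p (fun r hr => hp r (.inl (.inl hr))) a⟩
    · exact ⟨1, fun p hp => p.le_one_of_isometry _ (hp _ (.inl (.inr (.inl rfl))))⟩

/-- The crossed product `A ⋊_α ℤ` of a unital C*-algebra by an automorphism. -/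
abbrev CrossedProductInt (A : Type u) [CStarAlgebra A] (α : A ≃⋆ₐ[ℂ] A) : Type u :=
  (crossedPresentation A α).Alg

/-! ### The Toeplitz algebra and its crossed product by rotation -/

/-- One generator `v` with `v* v = 1`. -/
def toeplitzPresentation : CStarPresentation Unit where
  rel := {star (NCPoly.X ()) * NCPoly.X () - 1}
  bounded := fun _ => ⟨1, fun p hp => p.le_one_of_isometry _ (hp _ rfl)⟩

/-- The Toeplitz algebra: the universal C*-algebra generated by an isometry. -/
abbrev ToeplitzAlgebra : Type := toeplitzPresentation.Alg

/-- The generating isometry of the Toeplitz algebra. -/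
def ToeplitzAlgebra.v : ToeplitzAlgebra := toeplitzPresentation.gen ()

theorem ToeplitzAlgebra.star_v_mul_v : star ToeplitzAlgebra.v * ToeplitzAlgebra.v = 1 := by
  have h := toeplitzPresentation.ofPoly_rel (r := star (NCPoly.X ()) * NCPoly.X () - 1) rfl
  rwa [map_sub, map_mul, map_star, map_one, sub_eq_zero] at h

/-- The endomorphism `v ↦ z v` of the Toeplitz algebra, for `|z| = 1`. -/
def ToeplitzAlgebra.rotateHom (z : Circle) : ToeplitzAlgebra →⋆ₐ[ℂ] ToeplitzAlgebra :=
  toeplitzPresentation.lift (fun _ => (z : ℂ) • ToeplitzAlgebra.v) (by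
    rintro r rfl
    rw [map_sub, map_mul, map_star, map_one, NCPoly.eval_X, star_smul, smul_mul_smul_comm,
      ToeplitzAlgebra.star_v_mul_v, Complex.star_def, mul_comm, Complex.mul_conj]
    simp [Circle.normSq_coe])

theorem ToeplitzAlgebra.rotateHom_v (z : Circle) :
    ToeplitzAlgebra.rotateHom z ToeplitzAlgebra.v = (z : ℂ) • ToeplitzAlgebra.v :=
  toeplitzPresentation.lift_gen _ _ ()

theorem ToeplitzAlgebra.rotateHom_comp (z w : Circle) (h : z * w = 1) (x : ToeplitzAlgebra) :
    ToeplitzAlgebra.rotateHom z (ToeplitzAlgebra.rotateHom w x) = x := by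
  have hc : (ToeplitzAlgebra.rotateHom z).comp (ToeplitzAlgebra.rotateHom w) =
      StarAlgHom.id ℂ ToeplitzAlgebra := by
    refine toeplitzPresentation.hom_ext fun _ => ?_
    change ToeplitzAlgebra.rotateHom z (ToeplitzAlgebra.rotateHom w ToeplitzAlgebra.v) =
      ToeplitzAlgebra.v
    rw [ToeplitzAlgebra.rotateHom_v, map_smul, ToeplitzAlgebra.rotateHom_v, smul_smul, mul_comm,
      ← Circle.coe_mul, h, Circle.coe_one, one_smul]
  exact DFunLike.congr_fun hc x

/-- The automorphism `v ↦ z v` of the Toeplitz algebra, for `|z| = 1`. -/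
def ToeplitzAlgebra.rotate (z : Circle) : ToeplitzAlgebra ≃⋆ₐ[ℂ] ToeplitzAlgebra :=
  StarAlgEquiv.ofStarAlgHom (ToeplitzAlgebra.rotateHom z) (ToeplitzAlgebra.rotateHom z⁻¹)
    (by ext x; exact ToeplitzAlgebra.rotateHom_comp z⁻¹ z (inv_mul_cancel z) x)
    (by ext x; exact ToeplitzAlgebra.rotateHom_comp z z⁻¹ (mul_inv_cancel z) x)

/-- `λ = exp (2πiθ)`. -/
def twistScalar (θ : ℝ) : Circle := Circle.exp (2 * Real.pi * θ)

/-- The crossed product of the Toeplitz algebra by `ℤ` for the automorphism `v ↦ λ v`. -/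
abbrev ToeplitzCrossed (θ : ℝ) : Type :=
  CrossedProductInt ToeplitzAlgebra (ToeplitzAlgebra.rotate (twistScalar θ))

/-- The unitary of `𝒯 ⋊_θ ℤ` implementing the automorphism. -/
def ToeplitzCrossed.u (θ : ℝ) : ToeplitzCrossed θ :=
  (crossedPresentation ToeplitzAlgebra (ToeplitzAlgebra.rotate (twistScalar θ))).gen (Sum.inr ())

/-- The isometry of `𝒯 ⋊_θ ℤ` coming from the Toeplitz algebra. -/
def ToeplitzCrossed.v (θ : ℝ) : ToeplitzCrossed θ :=
  (crossedPresentation ToeplitzAlgebra (ToeplitzAlgebra.rotate (twistScalar θ))).gen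
    (Sum.inl ToeplitzAlgebra.v)

/-! ### The unital free product of `C(S¹)` and `ℂ²` -/

/-- `C(S¹) *_ℂ ℂ²`. -/
abbrev CircleFreeC2 : Type := UnitalFreeProduct C(Circle, ℂ) (ℂ × ℂ)

/-- The unitary generator: the image of the identity function of the circle. -/
def CircleFreeC2.u : CircleFreeC2 :=
  (freeProductPresentation C(Circle, ℂ) (ℂ × ℂ)).gen
    (Sum.inl ⟨fun z => (z : ℂ), continuous_subtype_val⟩)

/-- The projection generator: the image of `(1, 0)`. -/
def CircleFreeC2.p : CircleFreeC2 :=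
  (freeProductPresentation C(Circle, ℂ) (ℂ × ℂ)).gen (Sum.inr (1, 0))

/-! ### The free twist of two isometries -/

inductive TwistGen : Type
  | u
  | v

/-- Two generators with `u* u = 1`, `v* v = 1`, `u v = λ v u`. -/
def freeTwistPresentation (θ : ℝ) : CStarPresentation TwistGen where
  rel := {star (NCPoly.X .u) * NCPoly.X .u - 1, star (NCPoly.X .v) * NCPoly.X .v - 1,
    NCPoly.X .u * NCPoly.X .v - (twistScalar θ : ℂ) • (NCPoly.X .v * NCPoly.X .u)}
  bounded := by
    rintro (_ | _)
    · exact ⟨1, fun p hp => p.le_one_of_isometry _ (hp _ (.inl rfl))⟩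
    · exact ⟨1, fun p hp => p.le_one_of_isometry _ (hp _ (.inr (.inl rfl)))⟩

/-- The free twist of two isometries: the universal C*-algebra generated by two isometries `u`,
`v` with `u v = λ v u`, `λ = exp (2πiθ)`. -/
abbrev FreeTwist (θ : ℝ) : Type := (freeTwistPresentation θ).Alg

/-- The first generating isometry. -/
def FreeTwist.u (θ : ℝ) : FreeTwist θ := (freeTwistPresentation θ).gen .u

/-- The second generating isometry. -/
def FreeTwist.v (θ : ℝ) : FreeTwist θ := (freeTwistPresentation θ).gen .v

end

noncomputable section

universe u w

/-! ### Universal properties of the constructions -/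

/-! The prescribed images of `u` and `v` are again a twisted pair of isometries
(`FreeTwist.isTwistedPair_tensor`), so the universal property gives `ι`. For injectivity it is
enough, by GNS, that every representation `π` of the free twist on a Hilbert space `H` kills `ker
ι`.

Put `a = π u`, `b = π v`, `w = ab` (an isometry) and `e = 1 - ww*`. The Wold decomposition of `w` is
encoded by the single operator `S : H → ℓ²(ℕ, H)`, `S h = (e w*ⁿ h)ₙ`. The Berger–Coburn–Lebow
argument, done purely algebraically in `IsTwistedPair.exists_model`, yields a unitary `U` and a
projection `P` on `H` that describe `a`, `b` and their adjoints in these coordinates, up to powers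
of `λ`. These formulas are exactly those of `ι u` and `ι v` when `v` acts as the unilateral shift,
`u` as the diagonal unitary `(λⁿ)`, and `ū`, `p̄` as `U`, `P`. Hence `S π(x) = σ(ι x) S` for a
representation `σ` of the tensor product (`FreeTwist.exists_wold_intertwiner`).

The remaining part of `π` lives on `ker S`, which is invariant by the intertwining relation. There
`e = 0`, so `w` and then `a` are unitary, and the restricted representation factors through `ι` by
sending `u ↦ a`, `v ↦ ab`, `ū ↦ 1`, `p̄ ↦ 0` (`FreeTwist.exists_factorization_of_unitary`).

If `ι x = 0`, the first part puts the range of `π x` inside `ker S`, and the second makes `π(x*)`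
vanish on `ker S`. Thus `π(x)* π(x) = 0` and `π x = 0`; no orthogonal splitting of `H` is needed. -/

theorem StarAlgHom.continuous_of_cstar {A B : Type*} [CStarAlgebra A] [CStarAlgebra B]
    (φ : A →⋆ₐ[ℂ] B) : Continuous φ :=
  AddMonoidHomClass.continuous_of_bound φ 1 fun x => by
    simpa using NonUnitalStarAlgHom.norm_apply_le φ x

/-- A closed property of elements of a universal C*-algebra which holds for scalars, generators and
adjoints of generators and is stable under sums and products holds everywhere. -/
theorem CStarPresentation.induction_on {G : Type u} (R : CStarPresentation G)
    {motive : R.Alg → Prop} (closed : IsClosed {x | motive x})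
    (scalar : ∀ c : ℂ, motive (algebraMap ℂ R.Alg c))
    (gen : ∀ g, motive (R.gen g)) (star_gen : ∀ g, motive (star (R.gen g)))
    (mul : ∀ a b, motive a → motive b → motive (a * b))
    (add : ∀ a b, motive a → motive b → motive (a + b)) (x : R.Alg) : motive x := by
  have hd : DenseRange R.ofPoly := R.universalSeminorm.denseRange_ofHom
  refine hd.induction_on (p := motive) x closed fun y => ?_
  induction y using NCPoly.induction with
  | algebraMap c =>
    have h : R.ofPoly (algebraMap ℂ (NCPoly G) c) = algebraMap ℂ R.Alg c :=
      R.ofPoly.toAlgHom.commutes c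
    rw [h]
    exact scalar c
  | var i =>
    cases i with
    | inl g => exact gen g
    | inr g =>
      have h : NCPoly.var (Sum.inr g) = star (NCPoly.X g) := (NCPoly.star_var (Sum.inl g)).symm
      rw [h, map_star]
      exact star_gen g
  | mul a b ha hb => rw [map_mul]; exact mul _ _ ha hb
  | add a b ha hb => rw [map_add]; exact add _ _ ha hb

/-- Used in every lift below: the relations of `A` hold automatically once the chosen images of its
elements come from a *-homomorphism. -/
theorem RelationsOf.eval_eq_zero {A : Type u} [CStarAlgebra A] {G : Type w} {f : A → G}
    {B : Type*} [CStarAlgebra B] {y : G → B} (φ : A →⋆ₐ[ℂ] B) (h : ∀ a, y (f a) = φ a)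
    {r : NCPoly G} (hr : RelationsOf A f r) : NCPoly.eval y r = 0 := by
  cases hr <;> simp [NCPoly.eval_X, h, map_star]

/-! ### Calculus of elementary tensors -/

namespace CStarTensor

variable {A : Type u} {B : Type w} [CStarAlgebra A] [CStarAlgebra B]

/-- The map `a ↦ a ⊗ 1`. -/
def inl : A →⋆ₐ[ℂ] CStarTensor A B :=
  RelationsOf.hom (f := Sum.inl) (tensorPresentation A B).ofPoly fun _ hr =>
    (tensorPresentation A B).ofPoly_rel (.inl (.inl hr))

/-- The map `b ↦ 1 ⊗ b`. -/
def inr : B →⋆ₐ[ℂ] CStarTensor A B :=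
  RelationsOf.hom (f := Sum.inr) (tensorPresentation A B).ofPoly fun _ hr =>
    (tensorPresentation A B).ofPoly_rel (.inl (.inr hr))

theorem tmul_eq (a : A) (b : B) : tmul a b = inl a * inr b := rfl

theorem inl_mul_inr_comm (a : A) (b : B) :
    (inl a * inr b : CStarTensor A B) = inr b * inl a := by
  have h := (tensorPresentation A B).ofPoly_rel (.inr ⟨a, b, rfl⟩)
  rwa [map_sub, map_mul, map_mul, sub_eq_zero] at h

theorem tmul_mul_tmul (a c : A) (b d : B) :
    tmul a b * tmul c d = tmul (a * c) (b * d) := by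
  simp only [tmul_eq, map_mul]
  rw [mul_assoc, ← mul_assoc (inr b), ← inl_mul_inr_comm]
  simp only [mul_assoc]

theorem star_tmul (a : A) (b : B) : star (tmul a b) = tmul (star a) (star b) := by
  simp only [tmul_eq, star_mul, map_star]
  rw [← map_star, ← map_star, inl_mul_inr_comm]

theorem tmul_add (a : A) (b c : B) : tmul a (b + c) = tmul a b + tmul a c := by
  simp only [tmul_eq, map_add, mul_add]

theorem smul_tmul (z : ℂ) (a : A) (b : B) : tmul (z • a) b = z • tmul a b := by
  simp only [tmul_eq, map_smul, smul_mul_assoc]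

theorem tmul_zero (a : A) : tmul a (0 : B) = 0 := by
  simp only [tmul_eq, map_zero, mul_zero]

theorem tmul_one_one : tmul (1 : A) (1 : B) = 1 := by
  simp only [tmul_eq, map_one, mul_one]

/-- Two *-homomorphisms with commuting ranges define a *-homomorphism on the tensor product. -/
theorem exists_lift {C : Type*} [CStarAlgebra C] (φ : A →⋆ₐ[ℂ] C) (ψ : B →⋆ₐ[ℂ] C)
    (h : ∀ a b, φ a * ψ b = ψ b * φ a) :
    ∃ σ : CStarTensor A B →⋆ₐ[ℂ] C, ∀ a b, σ (tmul a b) = φ a * ψ b := by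
  refine ⟨(tensorPresentation A B).lift (Sum.elim φ ψ) ?_, fun a b => ?_⟩
  · rintro r ((hr | hr) | ⟨a, b, rfl⟩)
    · exact RelationsOf.eval_eq_zero (f := Sum.inl) φ (fun _ => rfl) hr
    · exact RelationsOf.eval_eq_zero (f := Sum.inr) ψ (fun _ => rfl) hr
    · simp [NCPoly.eval_X, h]
  · rw [tmul, map_mul, CStarPresentation.lift_gen, CStarPresentation.lift_gen]
    rfl

end CStarTensor

/-- Two *-homomorphisms define a *-homomorphism on the unital free product. -/
theorem UnitalFreeProduct.exists_lift {A : Type u} {B : Type w} [CStarAlgebra A] [CStarAlgebra B]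
    {C : Type*} [CStarAlgebra C] (φ : A →⋆ₐ[ℂ] C) (ψ : B →⋆ₐ[ℂ] C) :
    ∃ σ : UnitalFreeProduct A B →⋆ₐ[ℂ] C,
      (∀ a, σ ((freeProductPresentation A B).gen (Sum.inl a)) = φ a) ∧
      ∀ b, σ ((freeProductPresentation A B).gen (Sum.inr b)) = ψ b := by
  refine ⟨(freeProductPresentation A B).lift (Sum.elim φ ψ) ?_, fun a => ?_, fun b => ?_⟩
  · rintro r (hr | hr)
    · exact RelationsOf.eval_eq_zero (f := Sum.inl) φ (fun _ => rfl) hr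
    · exact RelationsOf.eval_eq_zero (f := Sum.inr) ψ (fun _ => rfl) hr
  · rw [CStarPresentation.lift_gen]; rfl
  · rw [CStarPresentation.lift_gen]; rfl

/-! ### The free product `C(S¹) *_ℂ ℂ²` -/

/-- A unitary defines a *-homomorphism on `C(S¹)`. -/
theorem exists_hom_circle {C : Type*} [CStarAlgebra C] {U : C} (hU : U ∈ unitary C) :
    ∃ φ : C(Circle, ℂ) →⋆ₐ[ℂ] C, φ ⟨fun z => (z : ℂ), continuous_subtype_val⟩ = U := by
  have hn : IsStarNormal U := ⟨by
    rw [commute_iff_eq, Unitary.star_mul_self_of_mem hU, Unitary.mul_star_self_of_mem hU]⟩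
  -- The spectrum of a unitary lies on the circle, so restriction to it followed by the continuous
  -- functional calculus is the required map.
  let j : C(spectrum ℂ U, Circle) :=
    ⟨fun z => ⟨z, spectrum.subset_circle_of_unitary hU z.2⟩, by fun_prop⟩
  refine ⟨(cfcHom hn).comp (ContinuousMap.compStarAlgHom' ℂ ℂ j), ?_⟩
  exact cfcHom_id hn

/-- A projection defines a *-homomorphism on `ℂ²`. -/
def IsStarProjection.prodHom {C : Type*} [CStarAlgebra C] {P : C} (hP : IsStarProjection P) :
    ℂ × ℂ →⋆ₐ[ℂ] C where
  toFun x := x.1 • P + x.2 • (1 - P)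
  map_one' := by simp
  map_zero' := by simp
  map_mul' x y := by
    have h := hP.isIdempotentElem.eq
    simp only [Prod.fst_mul, Prod.snd_mul, mul_add, add_mul, mul_sub, sub_mul, smul_mul_smul_comm,
      h, mul_one, one_mul]
    simp
  map_add' x y := by
    simp only [Prod.fst_add, Prod.snd_add]
    module
  commutes' c := by
    change c • P + c • (1 - P) = _
    rw [← smul_add, add_sub_cancel, Algebra.algebraMap_eq_smul_one]
  map_star' x := by
    simp [hP.isSelfAdjoint.star_eq]

/-- No relation between `U` and `P` is required; this freeness is what lets the arbitrary unitary
and projection of a Berger–Coburn–Lebow model enter. -/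
theorem CircleFreeC2.exists_lift {C : Type*} [CStarAlgebra C] {U P : C} (hU : U ∈ unitary C)
    (hP : IsStarProjection P) :
    ∃ ψ : CircleFreeC2 →⋆ₐ[ℂ] C, ψ CircleFreeC2.u = U ∧ ψ CircleFreeC2.p = P := by
  obtain ⟨φ, hφ⟩ := exists_hom_circle hU
  obtain ⟨ψ, h1, h2⟩ := UnitalFreeProduct.exists_lift φ hP.prodHom
  refine ⟨ψ, (h1 _).trans hφ, (h2 _).trans ?_⟩
  simp [IsStarProjection.prodHom]

theorem CircleFreeC2.u_mem_unitary : CircleFreeC2.u ∈ unitary CircleFreeC2 := by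
  let j : C(Circle, ℂ) →⋆ₐ[ℂ] CircleFreeC2 :=
    RelationsOf.hom (f := Sum.inl) (freeProductPresentation C(Circle, ℂ) (ℂ × ℂ)).ofPoly
      fun _ hr => (freeProductPresentation C(Circle, ℂ) (ℂ × ℂ)).ofPoly_rel (.inl hr)
  let f : C(Circle, ℂ) := ⟨fun z => (z : ℂ), continuous_subtype_val⟩
  have h1 : star f * f = 1 := by
    ext z
    change star (z : ℂ) * (z : ℂ) = 1
    rw [Complex.star_def, mul_comm, Complex.mul_conj, Circle.normSq_coe, Complex.ofReal_one]
  have h2 : f * star f = 1 := by rw [mul_comm, h1]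
  change j f ∈ unitary CircleFreeC2
  rw [Unitary.mem_iff, ← map_star, ← map_mul, ← map_mul, h1, h2, map_one]
  exact ⟨rfl, rfl⟩

theorem CircleFreeC2.isStarProjection_p : IsStarProjection CircleFreeC2.p := by
  let j : ℂ × ℂ →⋆ₐ[ℂ] CircleFreeC2 :=
    RelationsOf.hom (f := Sum.inr) (freeProductPresentation C(Circle, ℂ) (ℂ × ℂ)).ofPoly
      fun _ hr => (freeProductPresentation C(Circle, ℂ) (ℂ × ℂ)).ofPoly_rel (.inr hr)
  have h : IsStarProjection ((1, 0) : ℂ × ℂ) := ⟨by ext <;> simp, by ext <;> simp⟩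
  exact h.map j

/-! ### The crossed product of the Toeplitz algebra -/

section TwistedPair

variable {θ : ℝ}

theorem twistScalar_mul_star (θ : ℝ) : (twistScalar θ : ℂ) * star (twistScalar θ : ℂ) = 1 := by
  rw [Complex.star_def, Complex.mul_conj, Circle.normSq_coe, Complex.ofReal_one]

theorem star_mul_twistScalar (θ : ℝ) : star (twistScalar θ : ℂ) * (twistScalar θ : ℂ) = 1 := by
  rw [mul_comm, twistScalar_mul_star]

theorem ToeplitzAlgebra.exists_lift {C : Type*} [CStarAlgebra C] {V : C} (hV : star V * V = 1) :
    ∃ φ : ToeplitzAlgebra →⋆ₐ[ℂ] C, φ ToeplitzAlgebra.v = V :=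
  ⟨toeplitzPresentation.lift (fun _ => V) (by rintro r rfl; simp [NCPoly.eval_X, map_star, hV]),
    CStarPresentation.lift_gen _ _ _ _⟩

theorem ToeplitzCrossed.exists_lift {C : Type*} [CStarAlgebra C] {U V : C} (hU : U ∈ unitary C)
    (hV : star V * V = 1) (h : U * V = (twistScalar θ : ℂ) • (V * U)) :
    ∃ φ : ToeplitzCrossed θ →⋆ₐ[ℂ] C, φ (ToeplitzCrossed.u θ) = U ∧ φ (ToeplitzCrossed.v θ) = V := by
  obtain ⟨φ, hφ⟩ := ToeplitzAlgebra.exists_lift hV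
  have hα : ∀ a, U * φ a * star U = φ (ToeplitzAlgebra.rotate (twistScalar θ) a) := by
    -- Both sides of the covariance relation are *-homomorphisms in `a`, so it is enough to compare
    -- them at the generating isometry.
    have : ((Unitary.conjStarAlgAut ℂ C ⟨U, hU⟩ : C →⋆ₐ[ℂ] C)).comp φ =
        φ.comp (ToeplitzAlgebra.rotateHom (twistScalar θ)) := by
      refine toeplitzPresentation.hom_ext fun _ => ?_
      change U * φ ToeplitzAlgebra.v * star U =
        φ (ToeplitzAlgebra.rotateHom (twistScalar θ) ToeplitzAlgebra.v)
      rw [ToeplitzAlgebra.rotateHom_v, map_smul, hφ, h, smul_mul_assoc, mul_assoc,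
        Unitary.mul_star_self_of_mem hU, mul_one]
    exact fun a => DFunLike.congr_fun this a
  refine ⟨(crossedPresentation _ _).lift (Sum.elim φ fun _ => U) ?_,
    CStarPresentation.lift_gen _ _ _ _, (CStarPresentation.lift_gen _ _ _ _).trans hφ⟩
  rintro r ((hr | rfl | rfl) | ⟨a, rfl⟩)
  · exact RelationsOf.eval_eq_zero (f := Sum.inl) φ (fun _ => rfl) hr
  · simp [NCPoly.eval_X, map_star, Unitary.star_mul_self_of_mem hU]
  · simp [NCPoly.eval_X, map_star, Unitary.mul_star_self_of_mem hU]
  · simp [NCPoly.eval_X, map_star, hα]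

theorem ToeplitzCrossed.u_mem_unitary (θ : ℝ) :
    ToeplitzCrossed.u θ ∈ unitary (ToeplitzCrossed θ) := by
  let R := crossedPresentation ToeplitzAlgebra (ToeplitzAlgebra.rotate (twistScalar θ))
  have h1 := R.ofPoly_rel (.inl (.inr (.inl rfl)))
  have h2 := R.ofPoly_rel (.inl (.inr (.inr rfl)))
  rw [map_sub, map_mul, map_star, map_one, sub_eq_zero] at h1 h2
  exact ⟨h1, h2⟩

/-- The canonical map from the Toeplitz algebra to its crossed product. -/
def ToeplitzCrossed.ofToeplitz (θ : ℝ) : ToeplitzAlgebra →⋆ₐ[ℂ] ToeplitzCrossed θ :=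
  let R := crossedPresentation ToeplitzAlgebra (ToeplitzAlgebra.rotate (twistScalar θ))
  RelationsOf.hom (f := Sum.inl) R.ofPoly fun _ hr => R.ofPoly_rel (.inl (.inl hr))

theorem ToeplitzCrossed.star_v_mul_v (θ : ℝ) :
    star (ToeplitzCrossed.v θ) * ToeplitzCrossed.v θ = 1 := by
  change star (ofToeplitz θ ToeplitzAlgebra.v) * ofToeplitz θ ToeplitzAlgebra.v = 1
  rw [← map_star, ← map_mul, ToeplitzAlgebra.star_v_mul_v, map_one]

theorem ToeplitzCrossed.u_mul_v (θ : ℝ) :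
    ToeplitzCrossed.u θ * ToeplitzCrossed.v θ =
      (twistScalar θ : ℂ) • (ToeplitzCrossed.v θ * ToeplitzCrossed.u θ) := by
  let R := crossedPresentation ToeplitzAlgebra (ToeplitzAlgebra.rotate (twistScalar θ))
  have h := R.ofPoly_rel (.inr ⟨ToeplitzAlgebra.v, rfl⟩)
  rw [map_sub, map_mul, map_mul, map_star, sub_eq_zero] at h
  change ToeplitzCrossed.u θ * ToeplitzCrossed.v θ * star (ToeplitzCrossed.u θ) =
    ofToeplitz θ (ToeplitzAlgebra.rotateHom (twistScalar θ) ToeplitzAlgebra.v) at h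
  rw [ToeplitzAlgebra.rotateHom_v, map_smul] at h
  have h' := congrArg (· * ToeplitzCrossed.u θ) h
  simp only [mul_assoc, Unitary.star_mul_self_of_mem (u_mem_unitary θ), mul_one,
    smul_mul_assoc] at h'
  exact h'

/-- An element commuting with the images of the generators of `𝒯 ⋊_θ ℤ` and of their adjoints
commutes with the image of every element. -/
theorem ToeplitzCrossed.commute_map {C : Type*} [CStarAlgebra C] (φ : ToeplitzCrossed θ →⋆ₐ[ℂ] C)
    {b : C} (hv : Commute (φ (ToeplitzCrossed.v θ)) b)
    (hv' : Commute (star (φ (ToeplitzCrossed.v θ))) b)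
    (hu : Commute (φ (ToeplitzCrossed.u θ)) b)
    (hu' : Commute (star (φ (ToeplitzCrossed.u θ))) b) (a : ToeplitzCrossed θ) :
    Commute (φ a) b := by
  -- The presentation of the crossed product has every Toeplitz element as a generator, so these are
  -- reduced to `v` and `v*` first.
  have hT : ∀ t : ToeplitzAlgebra, Commute (φ (ofToeplitz θ t)) b := by
    intro t
    induction t using CStarPresentation.induction_on with
    | closed =>
      have hc := (φ.comp (ofToeplitz θ)).continuous_of_cstar
      exact isClosed_eq (hc.mul continuous_const) (continuous_const.mul hc)
    | scalar c =>
      rw [AlgHomClass.commutes, AlgHomClass.commutes]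
      exact Algebra.commutes _ _
    | gen g => exact hv
    | star_gen g => rw [map_star, map_star]; exact hv'
    | mul x y hx hy => rw [map_mul, map_mul]; exact hx.mul_left hy
    | add x y hx hy => rw [map_add, map_add]; exact hx.add_left hy
  induction a using CStarPresentation.induction_on with
  | closed =>
    have hc := φ.continuous_of_cstar
    exact isClosed_eq (hc.mul continuous_const) (continuous_const.mul hc)
  | scalar c =>
    rw [AlgHomClass.commutes]
    exact Algebra.commutes _ _
  | gen g =>
    rcases g with t | ⟨⟩
    · exact hT t
    · exact hu
  | star_gen g =>
    rcases g with t | ⟨⟩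
    · change Commute (φ (star (ofToeplitz θ t))) b
      rw [← map_star]
      exact hT _
    · rw [map_star]; exact hu'
  | mul x y hx hy => rw [map_mul]; exact hx.mul_left hy
  | add x y hx hy => rw [map_add]; exact hx.add_left hy

end TwistedPair

/-! ### Identities for a twisted pair of isometries in a *-algebra -/

/-- The element `e w*ⁿ`, where `e = 1 - w w*`. -/
def woldCoeff {B : Type*} [Ring B] [Star B] (w : B) (n : ℕ) : B :=
  (1 - w * star w) * star w ^ n

/-- Two isometries `a`, `b` with `a b = l b a`, where `|l| = 1`. -/
structure IsTwistedPair {B : Type*} [Ring B] [Algebra ℂ B] [StarRing B] (l : ℂ) (a b : B) :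
    Prop where
  scalar : star l * l = 1
  left : star a * a = 1
  right : star b * b = 1
  twist : a * b = l • (b * a)

namespace IsTwistedPair

variable {B : Type*} [Ring B] [Algebra ℂ B] [StarRing B] {l : ℂ} {a b : B}

theorem scalar' (h : IsTwistedPair l a b) : l * star l = 1 := by rw [mul_comm, h.scalar]

theorem left_assoc (h : IsTwistedPair l a b) (x : B) : star a * (a * x) = x := by
  rw [← mul_assoc, h.left, one_mul]

theorem right_assoc (h : IsTwistedPair l a b) (x : B) : star b * (b * x) = x := by
  rw [← mul_assoc, h.right, one_mul]

/-- The product of a twisted pair is an isometry. -/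
theorem star_mul_self (h : IsTwistedPair l a b) : star (a * b) * (a * b) = 1 := by
  rw [star_mul, mul_assoc, h.left_assoc, h.right]

variable [StarModule ℂ B]

theorem star_mul_star (h : IsTwistedPair l a b) :
    star b * star a = star l • (star a * star b) := by
  rw [← star_mul, h.twist, star_smul, star_mul]

theorem star_mul_star' (h : IsTwistedPair l a b) :
    star a * star b = l • (star b * star a) := by
  rw [h.star_mul_star, smul_smul, h.scalar', one_smul]

/-- The two ways to write the range projection of `a b`. -/
theorem range_proj (h : IsTwistedPair l a b) :
    a * b * (star b * star a) = b * a * (star a * star b) := by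
  rw [h.twist, h.star_mul_star, smul_mul_smul_comm, h.scalar', one_smul]

/-- The unitary and the projection of the Berger–Coburn–Lebow model of a twisted pair. -/
theorem exists_unitary_projection (h : IsTwistedPair l a b) :
    ∃ U P : B, U ∈ unitary B ∧ IsStarProjection P ∧
      (1 - a * b * star (a * b)) * a = U * (1 - P) * (1 - a * b * star (a * b)) ∧
      (1 - a * b * star (a * b)) * b = P * star U * (1 - a * b * star (a * b)) ∧
      (1 - a * b * star (a * b)) * star a =
        P * star U * (1 - a * b * star (a * b)) * star (a * b) +
          (1 - P) * star U * (1 - a * b * star (a * b)) ∧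
      (1 - a * b * star (a * b)) * star b =
        U * P * (1 - a * b * star (a * b)) +
          l • (U * (1 - P) * (1 - a * b * star (a * b)) * star (a * b)) := by
  -- On a Hilbert space, `ker w*` for `w = ab` splits both as `ker b* ⊕ b(ker a*)` and as `a(ker b*)
  -- ⊕ ker a*`, because `ab` and `ba` have the same range. Here `d` carries `ker b*` onto `a(ker
  -- b*)` via `a`, `c` carries `b(ker a*)` onto `ker a*` via `b*`, and `W` is the range projection
  -- of `w`.
  obtain ⟨c, hc⟩ : ∃ c, c = (1 - a * star a) * star b := ⟨_, rfl⟩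
  obtain ⟨d, hd⟩ : ∃ d, d = a * (1 - b * star b) := ⟨_, rfl⟩
  obtain ⟨W, hW⟩ : ∃ W, W = a * b * star (a * b) := ⟨_, rfl⟩
  have hc' : star c = b * (1 - a * star a) := by simp [hc]
  have hd' : star d = (1 - b * star b) * star a := by simp [hd]
  have hW1 : W = a * (b * (star b * star a)) := by rw [hW, star_mul, mul_assoc]
  have hW2 : W = b * (a * (star a * star b)) := by
    rw [hW, star_mul, h.range_proj, mul_assoc]
  have hWs : star W = W := by rw [hW]; simp
  have hl := h.left_assoc
  have hr := h.right_assoc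
  have hdc : d * star c = 0 := by
    rw [hc', hd]; simp only [mul_sub, sub_mul, mul_assoc, hr, h.right, mul_one]; abel
  have hcd : star c * d = 0 := by
    rw [hc', hd]; simp only [mul_sub, sub_mul, mul_assoc, hl, h.left, mul_one]; abel
  have hdd : d * star d = a * star a - W := by
    rw [hd', hd, hW1]; simp only [mul_sub, sub_mul, mul_assoc, hr, one_mul, mul_one]; abel
  have hdd' : star d * d = 1 - b * star b := by
    rw [hd', hd]; simp only [mul_sub, sub_mul, mul_assoc, hl, hr, h.left, one_mul, mul_one]; abel
  have hcc : c * star c = 1 - a * star a := by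
    rw [hc', hc]; simp only [mul_sub, sub_mul, mul_assoc, hl, hr, h.right, one_mul, mul_one]; abel
  have hcc' : star c * c = b * star b - W := by
    rw [hc', hc, hW2]; simp only [mul_sub, sub_mul, mul_assoc, hl, one_mul, mul_one]; abel
  have hWd : W * d = 0 := by
    rw [hd, hW1]; simp only [mul_sub, mul_assoc, hl, h.left, hr, mul_one]; abel
  have hWc : W * c = 0 := by
    rw [hc, hW1]; simp only [mul_sub, sub_mul, mul_assoc, hl, one_mul]; abel
  have hdW : d * W = 0 := by
    rw [hd, hW2]; simp only [mul_sub, sub_mul, mul_assoc, hr, mul_one]; abel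
  have hcW : c * W = 0 := by
    rw [hc, hW2]; simp only [sub_mul, mul_assoc, hl, hr, one_mul]; abel
  have hWW : W * W = W := by
    rw [hW1]; simp only [mul_assoc, hl, hr]
  have hdc2 : c * star d = 0 := by rw [← star_star (c * star d), star_mul, star_star, hdc, star_zero]
  have hcd2 : star d * c = 0 := by rw [← star_star (star d * c), star_mul, star_star, hcd, star_zero]
  have hWd2 : star d * W = 0 := by rw [← hWs, ← star_mul, hWd, star_zero]
  have hWc2 : star c * W = 0 := by rw [← hWs, ← star_mul, hWc, star_zero]
  have hdW2 : W * star d = 0 := by rw [← hWs, ← star_mul, hdW, star_zero]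
  have hcW2 : W * star c = 0 := by rw [← hWs, ← star_mul, hcW, star_zero]
  have hccc : c * (star c * c) = c := by
    rw [← mul_assoc, hcc, hc]; simp only [mul_sub, sub_mul, mul_assoc, hl, one_mul]; abel
  have hUP : (d + c + W) * (star c * c) = c := by
    rw [add_mul, add_mul, hccc, ← mul_assoc, hdc, ← mul_assoc, hcW2]; simp
  have hUQ : (d + c + W) * (1 - star c * c) = d + W := by
    rw [mul_sub, hUP, mul_one]; abel
  have hUP' : star c * c * star (d + c + W) = star c := by
    simpa using congrArg star hUP
  have hUQ' : (1 - star c * c) * star (d + c + W) = star d + W := by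
    rw [sub_mul, hUP', one_mul, star_add, star_add, hWs]; abel
  -- The initial projections of `d`, `c`, `W` are orthogonal with sum `1`, and so are the final
  -- ones. The summand `W` extends the unitary on `ker w*` by the identity, so that it is unitary in
  -- `B` itself. `P` is the initial projection of `c`.
  refine ⟨d + c + W, star c * c, ?_, ⟨?_, .star_mul_self c⟩, ?_, ?_, ?_, ?_⟩
  · rw [Unitary.mem_iff, star_add, star_add, hWs]
    simp only [add_mul, mul_add, hdc, hcd, hdd, hdd', hcc, hcc', hWd, hWc, hdW, hcW, hWW, hdc2,
      hcd2, hWd2, hWc2, hdW2, hcW2]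
    constructor <;> abel
  · rw [IsIdempotentElem, mul_assoc, hccc]
  · rw [hUQ, ← hW]
    simp only [mul_sub, sub_mul, add_mul, hWW, hdW, one_mul, mul_one]
    rw [hd, hW1]
    simp only [mul_sub, mul_assoc, h.left, mul_one]
    abel
  · rw [hUP', ← hW]
    simp only [mul_sub, sub_mul, hWc2, one_mul, mul_one]
    rw [hc', hW2]
    simp only [mul_sub, mul_assoc, h.right, mul_one]
    abel
  · rw [hUP', hUQ', ← hW]
    simp only [mul_sub, sub_mul, add_mul, hWc2, hWd2, hWW, one_mul, mul_one, sub_zero]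
    rw [hc', hd', hW2, star_mul]
    simp only [mul_sub, sub_mul, mul_assoc, one_mul, mul_one]
    abel
  · have hw : l • star (a * b) = star a * star b := by
      rw [star_mul, h.star_mul_star']
    rw [hUP, hUQ, ← hW, ← mul_smul_comm, hw]
    simp only [mul_sub, sub_mul, add_mul, hcW, hdW, hWW, one_mul, mul_one, sub_zero]
    rw [hc, hd, hW1]
    simp only [mul_sub, sub_mul, mul_assoc, one_mul, mul_one, zero_mul]
    abel

/-- Each factor `w* = b* a*` contributes one scalar when `a*` (or, in the next lemma, `b*`) passes
it. The resulting powers become the entries of the diagonal unitary in the model. -/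
theorem star_prod_pow_mul_star_left (h : IsTwistedPair l a b) (n : ℕ) :
    star (a * b) ^ n * star a = star l ^ n • (star a * star (a * b) ^ n) := by
  have h1 : star (a * b) * star a = star l • (star a * star (a * b)) := by
    rw [star_mul, h.star_mul_star, smul_mul_assoc, mul_assoc, h.star_mul_star]
  induction n with
  | zero => simp
  | succ n ih =>
    rw [pow_succ, mul_assoc, h1, mul_smul_comm, ← mul_assoc, ih, smul_mul_assoc, smul_smul,
      mul_assoc, pow_succ']

theorem star_prod_pow_mul_star_right (h : IsTwistedPair l a b) (n : ℕ) :
    star (a * b) ^ n * star b = l ^ n • (star b * star (a * b) ^ n) := by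
  have h1 : star (a * b) * star b = l • (star b * star (a * b)) := by
    rw [star_mul, mul_assoc, h.star_mul_star', mul_smul_comm]
  induction n with
  | zero => simp
  | succ n ih =>
    rw [pow_succ, mul_assoc, h1, mul_smul_comm, ← mul_assoc, ih, smul_mul_assoc, smul_smul,
      mul_assoc, pow_succ']

/-- One factor `w*` is consumed: `w* a = b*`, whereas `w* b = l̄ a*`. This explains the exponent `n`
here against `n + 1` in the next lemma. -/
theorem star_prod_pow_succ_mul_left (h : IsTwistedPair l a b) (n : ℕ) :
    star (a * b) ^ (n + 1) * a = l ^ n • (star b * star (a * b) ^ n) := by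
  rw [pow_succ, mul_assoc, star_mul, mul_assoc, h.left, mul_one, ← star_mul,
    h.star_prod_pow_mul_star_right]

theorem star_prod_pow_succ_mul_right (h : IsTwistedPair l a b) (n : ℕ) :
    star (a * b) ^ (n + 1) * b = star l ^ (n + 1) • (star a * star (a * b) ^ n) := by
  rw [pow_succ, mul_assoc, star_mul, h.star_mul_star, smul_mul_assoc, mul_assoc, h.right, mul_one,
    mul_smul_comm, ← h.star_mul_star, ← star_mul, h.star_prod_pow_mul_star_left, smul_smul,
    pow_succ']

/-- The Berger–Coburn–Lebow model of a twisted pair, in coordinates with respect to the Wold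
decomposition of the product. -/
theorem exists_model (h : IsTwistedPair l a b) :
    ∃ U P : B, U ∈ unitary B ∧ IsStarProjection P ∧
      woldCoeff (a * b) 0 * a = U * (1 - P) * woldCoeff (a * b) 0 ∧
      (∀ n, woldCoeff (a * b) (n + 1) * a =
        l ^ n • (U * P * woldCoeff (a * b) n) +
          l ^ (n + 1) • (U * (1 - P) * woldCoeff (a * b) (n + 1))) ∧
      (∀ n, woldCoeff (a * b) n * star a =
        star l ^ n • (P * star U * woldCoeff (a * b) (n + 1)) +
          star l ^ n • ((1 - P) * star U * woldCoeff (a * b) n)) ∧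
      woldCoeff (a * b) 0 * b = P * star U * woldCoeff (a * b) 0 ∧
      (∀ n, woldCoeff (a * b) (n + 1) * b =
        star l ^ (n + 1) • ((1 - P) * star U * woldCoeff (a * b) n) +
          star l ^ (n + 1) • (P * star U * woldCoeff (a * b) (n + 1))) ∧
      ∀ n, woldCoeff (a * b) n * star b =
        l ^ (n + 1) • (U * (1 - P) * woldCoeff (a * b) (n + 1)) +
          l ^ n • (U * P * woldCoeff (a * b) n) := by
  obtain ⟨U, P, hU, hP, h1, h2, h3, h4⟩ := h.exists_unitary_projection
  -- The formulas for `e b*` and `e a*` are multiplied on the right by `w*ⁿ`. They serve the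
  -- adjoints, and also `a` and `b` in positive degree, where `w*ⁿ⁺¹ a` and `w*ⁿ⁺¹ b` are multiples
  -- of `b* w*ⁿ` and `a* w*ⁿ`. Degree `0` has no `w*` to consume and is treated separately.
  have hb : ∀ n, (1 - a * b * star (a * b)) * (l ^ n • (star b * star (a * b) ^ n)) =
      l ^ n • (U * P * woldCoeff (a * b) n) +
        l ^ (n + 1) • (U * (1 - P) * woldCoeff (a * b) (n + 1)) := by
    intro n
    rw [mul_smul_comm, ← mul_assoc, h4, pow_succ l, mul_smul, ← smul_add, add_mul, woldCoeff,
      woldCoeff, pow_succ']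
    simp only [smul_mul_assoc, mul_assoc]
  have ha : ∀ n, (1 - a * b * star (a * b)) * (star a * star (a * b) ^ n) =
      P * star U * woldCoeff (a * b) (n + 1) + (1 - P) * star U * woldCoeff (a * b) n := by
    intro n
    rw [← mul_assoc, h3, add_mul, woldCoeff, woldCoeff, pow_succ']
    simp only [mul_assoc]
  refine ⟨U, P, hU, hP, ?_, fun n => ?_, fun n => ?_, ?_, fun n => ?_, fun n => ?_⟩
  · simpa [woldCoeff] using h1
  · rw [← hb, ← h.star_prod_pow_succ_mul_left, ← mul_assoc, woldCoeff]
  · rw [← smul_add, ← ha, ← mul_smul_comm, ← h.star_prod_pow_mul_star_left, ← mul_assoc, woldCoeff]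
  · simpa [woldCoeff] using h2
  · rw [← smul_add, add_comm ((1 - P) * _ * _), ← ha, ← mul_smul_comm,
      ← h.star_prod_pow_succ_mul_right, ← mul_assoc,
      woldCoeff]
  · rw [add_comm, ← hb, ← h.star_prod_pow_mul_star_right, ← mul_assoc, woldCoeff]

end IsTwistedPair

/-! ### Faithful families of representations -/

open scoped ComplexOrder in
/-- A positive functional which does not vanish on a given nonzero element `x* x`. -/
theorem CStarAlgebra.exists_positive_apply_star_mul_self_ne_zero {A : Type*} [CStarAlgebra A]
    [PartialOrder A] [StarOrderedRing A] {x : A} (hx : x ≠ 0) :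
    ∃ f : A →ₚ[ℂ] ℂ, f (star x * x) ≠ 0 := by
  have hy : 0 ≤ star x * x := star_mul_self_nonneg x
  have hm : -(star x * x) ∉ ProperCone.positive ℝ A := by
    rw [ProperCone.mem_positive, neg_nonneg]
    exact fun h => hx (CStarRing.star_mul_self_eq_zero_iff x |>.1 (le_antisymm h hy))
  obtain ⟨f, hf, hfx⟩ := (ProperCone.positive ℝ A).hyperplane_separation_point hm
  -- The separating functional `f` is only real linear; `g` is the complex linear functional
  -- agreeing with it on self-adjoint elements.
  let g : A →ₗ[ℂ] ℂ :=
    { toFun a := f (realPart a : A) + Complex.I * f (imaginaryPart a : A)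
      map_add' a b := by simp only [map_add, AddSubgroup.coe_add, Complex.ofReal_add]; ring
      map_smul' z a := by
        apply Complex.ext <;> simp [realPart_smul, imaginaryPart_smul] }
  have hg : ∀ a, IsSelfAdjoint a → g a = f a := fun a ha => by
    change (f (realPart a : A) + Complex.I * f (imaginaryPart a : A) : ℂ) = f a
    rw [ha.coe_realPart, ha.imaginaryPart]
    simp
  refine ⟨.mk₀ g fun a ha => ?_, ?_⟩
  · rw [hg a (.of_nonneg ha)]
    exact_mod_cast hf a ha
  · change g _ ≠ 0
    rw [hg _ (.star_mul_self x)]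
    rw [map_neg, neg_lt_zero] at hfx
    exact_mod_cast hfx.ne'

/-- Nonzero elements of a C*-algebra are nonzero in some representation on a Hilbert space. -/
theorem CStarAlgebra.exists_representation_ne_zero {A : Type u} [CStarAlgebra A] {x : A}
    (hx : x ≠ 0) :
    ∃ (H : Type u) (_ : NormedAddCommGroup H) (_ : InnerProductSpace ℂ H) (_ : CompleteSpace H)
      (π : A →⋆ₐ[ℂ] (H →L[ℂ] H)), π x ≠ 0 := by
  let _ := CStarAlgebra.spectralOrder A
  have _ := CStarAlgebra.spectralOrderedRing A
  obtain ⟨f, hf⟩ := exists_positive_apply_star_mul_self_ne_zero hx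
  refine ⟨f.GNS, inferInstance, inferInstance, inferInstance, f.gnsStarAlgHom, fun h => hf ?_⟩
  -- The vector of the unit detects `x`: the squared norm of its image is `f (x* x)`.
  have h1 : f.gnsNonUnitalStarAlgHom x ((f.toPreGNS 1 : f.PreGNS) : f.GNS) = 0 := by
    have : f.gnsNonUnitalStarAlgHom x = 0 := h
    rw [this]; rfl
  rw [PositiveLinearMap.gnsNonUnitalStarAlgHom_apply_coe] at h1
  have h2 : ‖f.leftMulMapPreGNS x (f.toPreGNS 1)‖ = 0 := by
    rw [← UniformSpace.Completion.norm_coe, h1, norm_zero]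
  have h3 := f.preGNS_norm_sq (f.leftMulMapPreGNS x (f.toPreGNS 1))
  rw [h2] at h3
  simpa using h3.symm

/-! ### Restriction of a representation to an invariant subspace -/

section Restrict

variable {H : Type*} [NormedAddCommGroup H] [InnerProductSpace ℂ H] [CompleteSpace H]

/-- The restriction of a representation to a closed invariant subspace. -/
theorem exists_restrict_hom {A : Type*} [CStarAlgebra A] (π : A →⋆ₐ[ℂ] (H →L[ℂ] H))
    (K : Submodule ℂ H) [CompleteSpace K] (hK : ∀ a, ∀ k ∈ K, π a k ∈ K) :
    ∃ ρ : A →⋆ₐ[ℂ] (K →L[ℂ] K), ∀ a k, (ρ a k : H) = π a k := by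
  let r : A → (K →L[ℂ] K) := fun a => ((π a).comp K.subtypeL).codRestrict K fun k => hK a k k.2
  have hr : ∀ a k, (r a k : H) = π a k := fun _ _ => rfl
  refine ⟨{ toFun := r, map_one' := ?_, map_mul' := ?_, map_zero' := ?_, map_add' := ?_,
            commutes' := ?_, map_star' := ?_ }, hr⟩
  · ext k; simp [hr]
  · intro a b; ext k; simp [hr]
  · ext k; simp [hr]
  · intro a b; ext k; simp [hr]
  · intro c; ext k; rw [hr, AlgHomClass.commutes]; rfl
  · intro a
    -- `K` is invariant under `π (a*)` too, so the adjoint of the restriction is the restriction of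
    -- the adjoint.
    rw [ContinuousLinearMap.star_eq_adjoint, ContinuousLinearMap.eq_adjoint_iff]
    intro x y
    rw [Submodule.coe_inner, Submodule.coe_inner, hr, hr, map_star,
      ContinuousLinearMap.star_eq_adjoint, ContinuousLinearMap.adjoint_inner_left]

end Restrict

/-! ### Operators on `ℓ²(ℕ, H)` -/

section EllTwo

/-- The space `ℓ²(ℕ, H)`. -/
abbrev EllTwo (H : Type*) [NormedAddCommGroup H] : Type _ := lp (fun _ : ℕ => H) 2

theorem lp.sum_range_norm_sq_le {H : Type*} [NormedAddCommGroup H] (ξ : EllTwo H) (N : ℕ) :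
    ∑ n ∈ Finset.range N, ‖ξ n‖ ^ 2 ≤ ‖ξ‖ ^ 2 := by
  have h := lp.sum_rpow_le_norm_rpow (p := 2) (by simp) ξ (Finset.range N)
  simpa only [ENNReal.toReal_ofNat, Real.rpow_two] using h

variable {H : Type*} [NormedAddCommGroup H] [InnerProductSpace ℂ H]

/-- A square summable family of linear maps defines a bounded operator to `ℓ²(ℕ, H)`. -/
theorem lp.exists_clm_of_components {E : Type*} [NormedAddCommGroup E] [NormedSpace ℂ E]
    (T : ℕ → E → H) (hadd : ∀ n x y, T n (x + y) = T n x + T n y)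
    (hsmul : ∀ n (c : ℂ) x, T n (c • x) = c • T n x) {C : ℝ} (hC : 0 ≤ C)
    (hT : ∀ x N, ∑ n ∈ Finset.range N, ‖T n x‖ ^ 2 ≤ (C * ‖x‖) ^ 2) :
    ∃ S : E →L[ℂ] EllTwo H, ∀ x n, S x n = T n x := by
  have hs : ∀ x (s : Finset ℕ),
      ∑ n ∈ s, ‖T n x‖ ^ (2 : ENNReal).toReal ≤ (C * ‖x‖) ^ (2 : ENNReal).toReal := by
    intro x s
    simp only [ENNReal.toReal_ofNat, Real.rpow_two]
    obtain ⟨N, hN⟩ := s.exists_nat_subset_range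
    exact (Finset.sum_le_sum_of_subset_of_nonneg hN fun _ _ _ => by positivity).trans (hT x N)
  let S : E →ₗ[ℂ] EllTwo H :=
    { toFun x := ⟨fun n => T n x, memℓp_gen' (hs x)⟩
      map_add' x y := by ext n; exact hadd n x y
      map_smul' c x := by ext n; exact hsmul n c x }
  exact ⟨S.mkContinuous C fun x =>
    lp.norm_le_of_forall_sum_le (by simp) (by positivity) (hs x), fun _ _ => rfl⟩

variable [CompleteSpace H]

/-- The amplification of operators on `H` to `ℓ²(ℕ, H)`. -/
theorem lp.exists_amplification :
    ∃ amp : (H →L[ℂ] H) →⋆ₐ[ℂ] (EllTwo H →L[ℂ] EllTwo H),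
      ∀ y ξ n, amp y ξ n = y (ξ n) := by
  have h : ∀ y : H →L[ℂ] H, ∃ S : EllTwo H →L[ℂ] EllTwo H,
      ∀ ξ n, S ξ n = y (ξ n) := fun y =>
    lp.exists_clm_of_components (fun n (ξ : EllTwo H) => y (ξ n)) (fun n x x' => by simp)
      (fun n c x => by simp) (norm_nonneg y) fun ξ N => by
        calc ∑ n ∈ Finset.range N, ‖y (ξ n)‖ ^ 2
            ≤ ∑ n ∈ Finset.range N, ‖y‖ ^ 2 * ‖ξ n‖ ^ 2 := by
              refine Finset.sum_le_sum fun n _ => ?_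
              rw [← mul_pow]
              exact pow_le_pow_left₀ (norm_nonneg _) (y.le_opNorm _) 2
          _ ≤ (‖y‖ * ‖ξ‖) ^ 2 := by
              rw [← Finset.mul_sum, mul_pow]
              exact mul_le_mul_of_nonneg_left (lp.sum_range_norm_sq_le ξ N) (by positivity)
  choose r hr using h
  refine ⟨{ toFun := r, map_one' := ?_, map_mul' := ?_, map_zero' := ?_, map_add' := ?_,
            commutes' := ?_, map_star' := ?_ }, hr⟩
  · ext ξ n; simp [hr]
  · intro a b; ext ξ n; simp [hr]
  · ext ξ n; simp [hr]
  · intro a b; ext ξ n; simp [hr]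
  · intro c; ext ξ n; simp [hr, Algebra.algebraMap_eq_smul_one]
  · intro a
    refine (ContinuousLinearMap.eq_adjoint_iff _ _).2 fun x y => ?_
    rw [lp.inner_eq_tsum, lp.inner_eq_tsum]
    refine tsum_congr fun n => ?_
    rw [hr, hr, ContinuousLinearMap.star_eq_adjoint, ContinuousLinearMap.adjoint_inner_left]

variable (H) in
/-- The unilateral shift on `ℓ²(ℕ, H)` and its adjoint. -/
theorem lp.exists_shift :
    ∃ V : EllTwo H →L[ℂ] EllTwo H,
      (∀ ξ, V ξ 0 = 0) ∧ (∀ ξ n, V ξ (n + 1) = ξ n) ∧ ∀ ξ n, star V ξ n = ξ (n + 1) := by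
  obtain ⟨V, hV⟩ := lp.exists_clm_of_components (E := EllTwo H)
    (fun n (ξ : EllTwo H) => Nat.casesOn (motive := fun _ => H) n 0 fun m => ξ m)
    (by rintro (_ | n) x y <;> simp) (by rintro (_ | n) c x <;> simp) zero_le_one (by
      rintro ξ (_ | N)
      · simp
      · rw [Finset.sum_range_succ']
        simpa using lp.sum_range_norm_sq_le ξ N)
  obtain ⟨W, hW⟩ := lp.exists_clm_of_components (E := EllTwo H)
    (fun n (ξ : EllTwo H) => ξ (n + 1)) (by simp) (by simp) zero_le_one (fun ξ N => by
      have h := lp.sum_range_norm_sq_le ξ (N + 1)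
      rw [Finset.sum_range_succ'] at h
      rw [one_mul]
      nlinarith [norm_nonneg (ξ 0)])
  have hV0 : ∀ ξ, V ξ 0 = 0 := fun ξ => hV ξ 0
  have hV1 : ∀ ξ n, V ξ (n + 1) = ξ n := fun ξ n => hV ξ (n + 1)
  have hWV : W = star V := by
    rw [ContinuousLinearMap.star_eq_adjoint, ContinuousLinearMap.eq_adjoint_iff]
    intro x y
    have hs : Summable fun n => inner ℂ (x n) (V y n) := lp.summable_inner x (V y)
    rw [lp.inner_eq_tsum, lp.inner_eq_tsum, hs.tsum_eq_zero_add, hV0, inner_zero_right, zero_add]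
    refine tsum_congr fun n => ?_
    rw [hV1, hW]
  exact ⟨V, hV0, hV1, hWV ▸ hW⟩

variable (H) in
/-- The diagonal unitary with entries `z ^ n` on `ℓ²(ℕ, H)` and its adjoint. -/
theorem lp.exists_diagonal {z : ℂ} (hz : star z * z = 1) :
    ∃ D : EllTwo H →L[ℂ] EllTwo H,
      (∀ ξ n, D ξ n = z ^ n • ξ n) ∧ ∀ ξ n, star D ξ n = star z ^ n • ξ n := by
  have hn : ‖z‖ = 1 := by
    have h := congrArg norm hz
    rw [norm_mul, norm_star, norm_one] at h
    nlinarith [norm_nonneg z]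
  have h : ∀ w : ℂ, ‖w‖ = 1 → ∃ D : EllTwo H →L[ℂ] EllTwo H,
      ∀ ξ n, D ξ n = w ^ n • ξ n := fun w hw =>
    lp.exists_clm_of_components (fun n (ξ : EllTwo H) => w ^ n • ξ n) (fun n x y => by simp)
      (fun n c x => smul_comm _ _ _) zero_le_one fun (ξ : EllTwo H) N => by
        simpa [norm_smul, hw] using lp.sum_range_norm_sq_le ξ N
  obtain ⟨D, hD⟩ := h z hn
  obtain ⟨D', hD'⟩ := h (star z) (by rw [norm_star, hn])
  have hDD : D' = star D := by
    rw [ContinuousLinearMap.star_eq_adjoint, ContinuousLinearMap.eq_adjoint_iff]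
    intro x y
    rw [lp.inner_eq_tsum, lp.inner_eq_tsum]
    refine tsum_congr fun n => ?_
    rw [hD, hD', inner_smul_left, inner_smul_right]
    simp
  exact ⟨D, hD, hDD ▸ hD'⟩

/-- The representation of `(𝒯 ⋊_θ ℤ) ⊗ (C(S¹) *_ℂ ℂ²)` on `ℓ²(ℕ, H)` by the unilateral shift, the
diagonal unitary with entries `λ ^ n`, and a given unitary and projection on `H`. -/
theorem exists_shift_representation (θ : ℝ) {U P : H →L[ℂ] H} (hU : U ∈ unitary (H →L[ℂ] H))
    (hP : IsStarProjection P) :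
    ∃ (σ : CStarTensor (ToeplitzCrossed θ) CircleFreeC2 →⋆ₐ[ℂ]
        (EllTwo H →L[ℂ] EllTwo H))
      (φ : ToeplitzCrossed θ →⋆ₐ[ℂ] (EllTwo H →L[ℂ] EllTwo H))
      (ψ : CircleFreeC2 →⋆ₐ[ℂ] (H →L[ℂ] H)),
      (∀ a b ξ n, σ (CStarTensor.tmul a b) ξ n = ψ b (φ a ξ n)) ∧
      ψ CircleFreeC2.u = U ∧ ψ CircleFreeC2.p = P ∧
      (∀ ξ, φ (ToeplitzCrossed.v θ) ξ 0 = 0) ∧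
      (∀ ξ n, φ (ToeplitzCrossed.v θ) ξ (n + 1) = ξ n) ∧
      (∀ ξ n, star (φ (ToeplitzCrossed.v θ)) ξ n = ξ (n + 1)) ∧
      (∀ ξ n, φ (ToeplitzCrossed.u θ) ξ n = (twistScalar θ : ℂ) ^ n • ξ n) ∧
      ∀ ξ n, star (φ (ToeplitzCrossed.u θ)) ξ n = star (twistScalar θ : ℂ) ^ n • ξ n := by
  obtain ⟨amp, hamp⟩ := lp.exists_amplification (H := H)
  obtain ⟨V, hV0, hV1, hV'⟩ := lp.exists_shift H
  obtain ⟨D, hD, hD'⟩ := lp.exists_diagonal H (star_mul_twistScalar θ)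
  obtain ⟨ψ, hψu, hψp⟩ := CircleFreeC2.exists_lift hU hP
  have hDu : D ∈ unitary (EllTwo H →L[ℂ] EllTwo H) := by
    rw [Unitary.mem_iff]
    constructor <;> ext ξ n <;>
      simp only [mul_apply_eq_comp, hD, hD', smul_smul, ← mul_pow,
        star_mul_twistScalar, twistScalar_mul_star, one_pow, one_smul,
        one_apply_eq_self]
  have hVi : star V * V = 1 := by
    ext ξ n
    rw [mul_apply_eq_comp, hV', hV1]
    rfl
  have hDV : D * V = (twistScalar θ : ℂ) • (V * D) := by
    ext ξ n
    rw [smul_apply, lp.coeFn_smul, Pi.smul_apply,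
      mul_apply_eq_comp, mul_apply_eq_comp, hD]
    rcases n with _ | n
    · simp [hV0]
    · rw [hV1, hV1, hD, smul_smul, pow_succ']
  obtain ⟨φ, hφu, hφv⟩ := ToeplitzCrossed.exists_lift hDu hVi hDV
  -- The shift and the diagonal act on the index with scalar weights, the amplification only on the
  -- values in `H`.
  have hc : ∀ a b, φ a * amp.comp ψ b = amp.comp ψ b * φ a := by
    intro a b
    refine ToeplitzCrossed.commute_map φ ?_ ?_ ?_ ?_ a
    · rw [hφv]
      ext ξ n
      change V (amp (ψ b) ξ) n = amp (ψ b) (V ξ) n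
      rcases n with _ | n
      · simp [hV0, hamp]
      · rw [hV1, hamp, hamp, hV1]
    · rw [hφv]
      ext ξ n
      change star V (amp (ψ b) ξ) n = amp (ψ b) (star V ξ) n
      rw [hV', hamp, hamp, hV']
    · rw [hφu]
      ext ξ n
      change D (amp (ψ b) ξ) n = amp (ψ b) (D ξ) n
      rw [hD, hamp, hamp, hD, map_smul]
    · rw [hφu]
      ext ξ n
      change star D (amp (ψ b) ξ) n = amp (ψ b) (star D ξ) n
      rw [hD', hamp, hamp, hD', map_smul]
  obtain ⟨σ, hσ⟩ := CStarTensor.exists_lift φ (amp.comp ψ) hc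
  refine ⟨σ, φ, ψ, fun a b ξ n => ?_, hψu, hψp, hφv ▸ hV0, hφv ▸ hV1, hφv ▸ hV', hφu ▸ hD,
    hφu ▸ hD'⟩
  rw [hσ, hc]
  exact hamp _ _ _

end EllTwo

/-! ### The shift part of a twisted pair of isometries -/

section ShiftPart

variable {H : Type*} [NormedAddCommGroup H] [InnerProductSpace ℂ H] [CompleteSpace H]

/-- The operator `h ↦ (e w*ⁿ h)ₙ`, `e = 1 - w w*`, for an isometry `w`. -/
theorem exists_wold_operator {w : H →L[ℂ] H} (hw : star w * w = 1) :
    ∃ S : H →L[ℂ] EllTwo H,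
      ∀ x n, S x n = woldCoeff w n x := by
  -- Because `e` is a projection, `‖e x‖² = ⟨e x, x⟩`. Applied at `w*ⁿ x`, this makes the sum below
  -- telescope and gives `‖S‖ ≤ 1`.
  have he : ∀ x, ‖(1 - w * star w) x‖ ^ 2 = ‖x‖ ^ 2 - ‖star w x‖ ^ 2 := by
    intro x
    have hsq : ∀ (T : H →L[ℂ] H), ‖T x‖ ^ 2 = (inner ℂ ((star T * T) x) x).re := fun T =>
      T.apply_norm_sq_eq_inner_adjoint_left x
    have h1 : star (1 - w * star w) * (1 - w * star w) = 1 - w * star w := by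
      have : w * star w * (w * star w) = w * star w := by
        rw [mul_assoc, ← mul_assoc (star w), hw, one_mul]
      simp only [star_sub, star_one, star_mul, star_star, mul_sub, sub_mul, mul_one, one_mul, this]
      abel
    have h2 := hsq 1
    rw [hsq, hsq (star w), h1, star_star]
    rw [star_one, one_mul] at h2
    simp only [one_apply_eq_self] at h2
    rw [h2, sub_apply, inner_sub_left, Complex.sub_re,
      one_apply_eq_self]
  refine lp.exists_clm_of_components (fun n x => ((1 - w * star w) * star w ^ n) x)
    (fun n x y => map_add _ x y)
    (fun n c x => map_smul _ c x) zero_le_one fun x N => ?_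
  have hN : ∑ n ∈ Finset.range N, ‖((1 - w * star w) * star w ^ n) x‖ ^ 2 =
      ‖x‖ ^ 2 - ‖(star w ^ N) x‖ ^ 2 := by
    induction N with
    | zero => simp
    | succ N ih =>
      rw [Finset.sum_range_succ, ih, mul_apply_eq_comp, he, pow_succ' (star w),
        mul_apply_eq_comp]
      ring
  rw [hN, one_mul]
  nlinarith [norm_nonneg ((star w ^ N) x)]

end ShiftPart

/-! ### The free twist of two isometries -/

namespace FreeTwist

theorem isTwistedPair_map {θ : ℝ} {C : Type*} [CStarAlgebra C] (π : FreeTwist θ →⋆ₐ[ℂ] C) :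
    IsTwistedPair (twistScalar θ : ℂ) (π (FreeTwist.u θ)) (π (FreeTwist.v θ)) := by
  have h1 := (freeTwistPresentation θ).ofPoly_rel (.inl rfl)
  have h2 := (freeTwistPresentation θ).ofPoly_rel (.inr (.inl rfl))
  have h3 := (freeTwistPresentation θ).ofPoly_rel (.inr (.inr rfl))
  rw [map_sub, map_mul, map_star, map_one, sub_eq_zero] at h1 h2
  rw [map_sub, map_smul, map_mul, map_mul, sub_eq_zero] at h3
  refine ⟨star_mul_twistScalar θ, ?_, ?_, ?_⟩
  · rw [← map_star, ← map_mul, ← map_one π]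
    exact congrArg π h1
  · rw [← map_star, ← map_mul, ← map_one π]
    exact congrArg π h2
  · rw [← map_mul, ← map_mul, ← map_smul]
    exact congrArg π h3

/-- A twisted pair of isometries defines a *-homomorphism on the free twist. -/
theorem exists_lift {θ : ℝ} {C : Type*} [CStarAlgebra C] {a b : C}
    (h : IsTwistedPair (twistScalar θ : ℂ) a b) :
    ∃ π : FreeTwist θ →⋆ₐ[ℂ] C, π (FreeTwist.u θ) = a ∧ π (FreeTwist.v θ) = b := by
  refine ⟨(freeTwistPresentation θ).lift (fun g => TwistGen.casesOn g a b) ?_,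
    CStarPresentation.lift_gen _ _ _ _, CStarPresentation.lift_gen _ _ _ _⟩
  rintro r (rfl | rfl | rfl)
  · simp [NCPoly.eval_X, map_star, h.left]
  · simp [NCPoly.eval_X, map_star, h.right]
  · simp [NCPoly.eval_X, h.twist]

/-- An operator which intertwines two representations on the generators and their adjoints
intertwines them. -/
theorem intertwine {θ : ℝ} {H K : Type*} [NormedAddCommGroup H] [InnerProductSpace ℂ H]
    [CompleteSpace H] [NormedAddCommGroup K] [InnerProductSpace ℂ K] [CompleteSpace K]
    (π : FreeTwist θ →⋆ₐ[ℂ] (H →L[ℂ] H)) (σ : FreeTwist θ →⋆ₐ[ℂ] (K →L[ℂ] K)) (S : H →L[ℂ] K)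
    (hu : ∀ x, S (π (FreeTwist.u θ) x) = σ (FreeTwist.u θ) (S x))
    (hu' : ∀ x, S (star (π (FreeTwist.u θ)) x) = star (σ (FreeTwist.u θ)) (S x))
    (hv : ∀ x, S (π (FreeTwist.v θ) x) = σ (FreeTwist.v θ) (S x))
    (hv' : ∀ x, S (star (π (FreeTwist.v θ)) x) = star (σ (FreeTwist.v θ)) (S x))
    (a : FreeTwist θ) : ∀ x, S (π a x) = σ a (S x) := by
  induction a using CStarPresentation.induction_on with
  | closed =>
    rw [Set.ofPred_forall]
    refine isClosed_iInter fun x => isClosed_eq ?_ ?_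
    · exact S.continuous.comp (π.continuous_of_cstar.clm_apply continuous_const)
    · exact σ.continuous_of_cstar.clm_apply continuous_const
  | scalar c =>
    intro x
    rw [AlgHomClass.commutes, AlgHomClass.commutes, Algebra.algebraMap_eq_smul_one,
      Algebra.algebraMap_eq_smul_one]
    exact map_smul S c x
  | gen g => rcases g with _ | _; exacts [hu, hv]
  | star_gen g =>
    rw [map_star, map_star]
    rcases g with _ | _
    exacts [hu', hv']
  | mul a b ha hb =>
    intro x
    rw [map_mul, map_mul, mul_apply_eq_comp, mul_apply_eq_comp, ha, hb]
  | add a b ha hb =>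
    intro x
    rw [map_add, map_add, add_apply, add_apply, map_add, ha, hb]

/-- The image of `u` in `(𝒯 ⋊_θ ℤ) ⊗ (C(S¹) *_ℂ ℂ²)`. -/
def tensorU (θ : ℝ) : CStarTensor (ToeplitzCrossed θ) CircleFreeC2 :=
  CStarTensor.tmul (ToeplitzCrossed.v θ * ToeplitzCrossed.u θ) (CircleFreeC2.u * CircleFreeC2.p) +
    CStarTensor.tmul (ToeplitzCrossed.u θ) (CircleFreeC2.u * (1 - CircleFreeC2.p))

/-- The image of `v` in `(𝒯 ⋊_θ ℤ) ⊗ (C(S¹) *_ℂ ℂ²)`. -/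
def tensorV (θ : ℝ) : CStarTensor (ToeplitzCrossed θ) CircleFreeC2 :=
  CStarTensor.tmul (star (ToeplitzCrossed.u θ) * ToeplitzCrossed.v θ)
      ((1 - CircleFreeC2.p) * star CircleFreeC2.u) +
    CStarTensor.tmul (star (ToeplitzCrossed.u θ)) (CircleFreeC2.p * star CircleFreeC2.u)

theorem star_tensorU (θ : ℝ) : star (tensorU θ) =
    CStarTensor.tmul (star (ToeplitzCrossed.u θ) * star (ToeplitzCrossed.v θ))
      (CircleFreeC2.p * star CircleFreeC2.u) +
    CStarTensor.tmul (star (ToeplitzCrossed.u θ))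
      ((1 - CircleFreeC2.p) * star CircleFreeC2.u) := by
  rw [tensorU, star_add, CStarTensor.star_tmul, CStarTensor.star_tmul, star_mul, star_mul, star_mul,
    star_sub, star_one, CircleFreeC2.isStarProjection_p.isSelfAdjoint.star_eq]

theorem star_tensorV (θ : ℝ) : star (tensorV θ) =
    CStarTensor.tmul (star (ToeplitzCrossed.v θ) * ToeplitzCrossed.u θ)
      (CircleFreeC2.u * (1 - CircleFreeC2.p)) +
    CStarTensor.tmul (ToeplitzCrossed.u θ) (CircleFreeC2.u * CircleFreeC2.p) := by
  rw [tensorV, star_add, CStarTensor.star_tmul, CStarTensor.star_tmul, star_mul, star_mul, star_mul,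
    star_sub, star_one, CircleFreeC2.isStarProjection_p.isSelfAdjoint.star_eq, star_star, star_star]

/-- Orthogonality of `p` and `1 - p` removes the cross terms, and the surviving ones recombine
through `p + (1 - p) = 1` or its conjugate by `ū`. The product of the images of `u` and `v` is `v ⊗
1`, in the opposite order it is `u* v u ⊗ 1`, and `λ u* v u = v`. -/
theorem isTwistedPair_tensor (θ : ℝ) :
    IsTwistedPair (twistScalar θ : ℂ) (tensorU θ) (tensorV θ) := by
  have hu := Unitary.star_mul_self_of_mem (ToeplitzCrossed.u_mem_unitary θ)
  have hu' := Unitary.mul_star_self_of_mem (ToeplitzCrossed.u_mem_unitary θ)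
  have hv := ToeplitzCrossed.star_v_mul_v θ
  have huv := ToeplitzCrossed.u_mul_v θ
  have hz := Unitary.star_mul_self_of_mem CircleFreeC2.u_mem_unitary
  have hz' := Unitary.mul_star_self_of_mem CircleFreeC2.u_mem_unitary
  have hp := CircleFreeC2.isStarProjection_p.isIdempotentElem.eq
  have hsU := star_tensorU θ
  have hsV := star_tensorV θ
  rw [tensorU] at hsU ⊢
  rw [tensorV] at hsV ⊢
  generalize ToeplitzCrossed.u θ = u at *
  generalize ToeplitzCrossed.v θ = v at *
  generalize CircleFreeC2.u = z at *
  generalize CircleFreeC2.p = p at *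
  have hq : (1 - p) * (1 - p) = 1 - p := by simp only [mul_sub, sub_mul, hp, mul_one, one_mul]; abel
  have hpq : p * (1 - p) = 0 := by rw [mul_sub, hp, mul_one, sub_self]
  have hqp : (1 - p) * p = 0 := by rw [sub_mul, hp, one_mul, sub_self]
  have inner : ∀ x y, x * star z * (z * y) = x * y := fun x y => by
    rw [mul_assoc, ← mul_assoc (star z), hz, one_mul]
  have outer : ∀ x y, z * x * (y * star z) = z * (x * y) * star z := fun x y => by
    simp only [mul_assoc]
  have hsum : p + (1 - p) = 1 := by abel
  have hsum' : z * p * star z + z * (1 - p) * star z = 1 := by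
    rw [← add_mul, ← mul_add, hsum, mul_one, hz']
  have huu : ∀ x, star u * (u * x) = x := fun x => by rw [← mul_assoc, hu, one_mul]
  have huu' : ∀ x, u * (star u * x) = x := fun x => by rw [← mul_assoc, hu', one_mul]
  have hvv : ∀ x, star v * (v * x) = x := fun x => by rw [← mul_assoc, hv, one_mul]
  refine ⟨star_mul_twistScalar θ, ?_, ?_, ?_⟩
  · rw [hsU]
    simp only [add_mul, mul_add, CStarTensor.tmul_mul_tmul, inner, hp, hq, hpq, hqp,
      CStarTensor.tmul_zero, mul_assoc, hvv, hu, add_zero, zero_add]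
    rw [← CStarTensor.tmul_add, hsum, CStarTensor.tmul_one_one]
  · rw [hsV]
    simp only [add_mul, mul_add, CStarTensor.tmul_mul_tmul, outer, hp, hq, hpq, hqp,
      CStarTensor.tmul_zero, mul_zero, zero_mul, mul_assoc, huu', hv, hu', add_zero, zero_add]
    simp only [← mul_assoc]
    rw [add_comm, ← CStarTensor.tmul_add, hsum', CStarTensor.tmul_one_one]
  · have h1 : (twistScalar θ : ℂ) • (star u * (v * u)) = v := by
      rw [← mul_smul_comm, ← huv, huu]
    simp only [add_mul, mul_add, CStarTensor.tmul_mul_tmul, inner, outer, hp, hq, hpq, hqp,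
      CStarTensor.tmul_zero, mul_zero, zero_mul, mul_assoc, huu', hu', add_zero, zero_add, mul_one]
    simp only [← mul_assoc z]
    rw [← CStarTensor.tmul_add, add_comm, ← CStarTensor.tmul_add, hsum, hsum',
      ← CStarTensor.smul_tmul, h1]

end FreeTwist

/-! ### Injectivity -/

/-- A representation of the free twist in which the product of the two isometries is unitary
factors through any map to `(𝒯 ⋊_θ ℤ) ⊗ (C(S¹) *_ℂ ℂ²)` with the prescribed values. -/
theorem FreeTwist.exists_factorization_of_unitary {θ : ℝ}
    (ι : FreeTwist θ →⋆ₐ[ℂ] CStarTensor (ToeplitzCrossed θ) CircleFreeC2)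
    (hιu : ι (FreeTwist.u θ) = tensorU θ) (hιv : ι (FreeTwist.v θ) = tensorV θ)
    {C : Type*} [CStarAlgebra C] (π : FreeTwist θ →⋆ₐ[ℂ] C)
    (hw : π (FreeTwist.u θ) * π (FreeTwist.v θ) *
      star (π (FreeTwist.u θ) * π (FreeTwist.v θ)) = 1) :
    ∃ τ : CStarTensor (ToeplitzCrossed θ) CircleFreeC2 →⋆ₐ[ℂ] C, ∀ x, τ (ι x) = π x := by
  have h := isTwistedPair_map π
  -- The range of `a` contains that of `ab`, which is everything: `aa* = aa* ww* = ww* = 1`.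
  have hU : π (FreeTwist.u θ) ∈ unitary C := by
    refine ⟨h.left, ?_⟩
    set a := π (FreeTwist.u θ)
    set b := π (FreeTwist.v θ)
    calc a * star a = a * star a * (a * b * star (a * b)) := by rw [hw, mul_one]
      _ = a * (star a * (a * (b * star (a * b)))) := by simp only [mul_assoc]
      _ = 1 := by rw [h.left_assoc, ← mul_assoc, hw]
  obtain ⟨φ, hφu, hφv⟩ := ToeplitzCrossed.exists_lift (θ := θ) hU h.star_mul_self (by
    rw [mul_assoc, ← mul_smul_comm, ← h.twist])
  -- With `ū ↦ 1` and `p ↦ 0`, only `u ⊗ 1` and `u* v ⊗ 1` survive in the two images; as `u ↦ a` and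
  -- `v ↦ ab`, they go to `a` and `a* a b = b`. Scalar values make the ranges commute.
  obtain ⟨ψ, hψu, hψp⟩ := CircleFreeC2.exists_lift (C := ℂ) (one_mem _) (.zero ℂ)
  obtain ⟨τ, hτ⟩ := CStarTensor.exists_lift φ ((StarAlgHom.ofId ℂ C).comp ψ)
    fun a b => (Algebra.commutes (ψ b) (φ a)).symm
  refine ⟨τ, DFunLike.congr_fun (f := τ.comp ι) (CStarPresentation.hom_ext _ ?_)⟩
  rintro (_ | _)
  · change τ (ι (FreeTwist.u θ)) = π (FreeTwist.u θ)
    rw [hιu, tensorU]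
    simp [hτ, hψu, hψp, hφu]
  · change τ (ι (FreeTwist.v θ)) = π (FreeTwist.v θ)
    rw [hιv, tensorV]
    simp [hτ, hψu, hψp, hφu, hφv, map_star, h.left_assoc]

/-- The Wold operator of the product intertwines a representation of the free twist with a
representation which factors through `(𝒯 ⋊_θ ℤ) ⊗ (C(S¹) *_ℂ ℂ²)`. -/
theorem FreeTwist.exists_wold_intertwiner {θ : ℝ}
    (ι : FreeTwist θ →⋆ₐ[ℂ] CStarTensor (ToeplitzCrossed θ) CircleFreeC2)
    (hιu : ι (FreeTwist.u θ) = tensorU θ) (hιv : ι (FreeTwist.v θ) = tensorV θ)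
    {H : Type*} [NormedAddCommGroup H] [InnerProductSpace ℂ H] [CompleteSpace H]
    (π : FreeTwist θ →⋆ₐ[ℂ] (H →L[ℂ] H)) :
    ∃ (σ : CStarTensor (ToeplitzCrossed θ) CircleFreeC2 →⋆ₐ[ℂ] (EllTwo H →L[ℂ] EllTwo H))
      (S : H →L[ℂ] EllTwo H),
      (∀ x n, S x n = woldCoeff (π (FreeTwist.u θ) * π (FreeTwist.v θ)) n x) ∧
      ∀ a x, S (π a x) = σ (ι a) (S x) := by
  have h := isTwistedPair_map π
  obtain ⟨U, P, hU, hP, ha0, ha, ha', hb0, hb, hb'⟩ := h.exists_model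
  obtain ⟨S, hS⟩ := exists_wold_operator h.star_mul_self
  obtain ⟨σ, φ, ψ, hσ, hψu, hψp, hv0, hv, hv', hu, hu'⟩ := exists_shift_representation θ hU hP
  refine ⟨σ, S, hS, intertwine π (σ.comp ι) S (fun x => ?_) (fun x => ?_) (fun x => ?_)
    fun x => ?_⟩
  · change _ = σ (ι (FreeTwist.u θ)) (S x)
    rw [hιu, tensorU, map_add]
    ext n
    rw [hS, ← mul_apply_eq_comp, add_apply, lp.coeFn_add, Pi.add_apply, hσ, hσ, map_mul φ,
      map_mul ψ, map_mul ψ, map_sub, map_one, hψu, hψp, mul_apply_eq_comp (φ _)]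
    -- In coordinate `0` the shift contributes nothing. The adjoints need no such case split, since
    -- the backward shift has one formula for all `n`.
    rcases n with _ | n
    · rw [ha0, hv0, hu, hS, map_zero, zero_add, pow_zero, one_smul, mul_apply_eq_comp (U * (1 - P))]
    · rw [ha, hv, hu, hu, hS, hS, map_smul, map_smul]
      rfl
  · change _ = star (σ (ι (FreeTwist.u θ))) (S x)
    rw [hιu, ← map_star σ, star_tensorU, map_add]
    ext n
    rw [hS, ← mul_apply_eq_comp, add_apply, lp.coeFn_add, Pi.add_apply, hσ, hσ, map_mul φ,
      map_mul ψ, map_mul ψ, map_sub, map_one, map_star, map_star, map_star, hψu, hψp,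
      mul_apply_eq_comp (star _), hu', hu', hv', hS, hS, map_smul, map_smul, ha']
    rfl
  · change _ = σ (ι (FreeTwist.v θ)) (S x)
    rw [hιv, tensorV, map_add]
    ext n
    rw [hS, ← mul_apply_eq_comp, add_apply, lp.coeFn_add, Pi.add_apply, hσ, hσ, map_mul φ,
      map_mul ψ, map_mul ψ, map_sub, map_one, map_star, map_star, hψu, hψp,
      mul_apply_eq_comp (star _), hu', hu']
    rcases n with _ | n
    · rw [hb0, hv0, hS, smul_zero, map_zero, zero_add, pow_zero, one_smul,
        mul_apply_eq_comp (P * star U)]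
    · rw [hb, hv, hS, hS, map_smul, map_smul]
      rfl
  · change _ = star (σ (ι (FreeTwist.v θ))) (S x)
    rw [hιv, ← map_star σ, star_tensorV, map_add]
    ext n
    rw [hS, ← mul_apply_eq_comp, add_apply, lp.coeFn_add, Pi.add_apply, hσ, hσ, map_mul φ,
      map_mul ψ, map_mul ψ, map_sub, map_one, map_star, hψu, hψp,
      mul_apply_eq_comp (star _), hv', hu, hu, hS, hS, map_smul, map_smul, hb']
    rfl

/-- Elements in the kernel of `ι` vanish in every representation on a Hilbert space. -/
theorem FreeTwist.representation_eq_zero {θ : ℝ}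
    (ι : FreeTwist θ →⋆ₐ[ℂ] CStarTensor (ToeplitzCrossed θ) CircleFreeC2)
    (hιu : ι (FreeTwist.u θ) = tensorU θ) (hιv : ι (FreeTwist.v θ) = tensorV θ)
    {H : Type*} [NormedAddCommGroup H] [InnerProductSpace ℂ H] [CompleteSpace H]
    (π : FreeTwist θ →⋆ₐ[ℂ] (H →L[ℂ] H)) {x : FreeTwist θ} (hx : ι x = 0) : π x = 0 := by
  obtain ⟨σ, S, hS, hint⟩ := exists_wold_intertwiner ι hιu hιv π
  have hK : ∀ k, k ∈ S.ker ↔ S k = 0 := fun k => Iff.rfl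
  obtain ⟨ρ, hρ⟩ := exists_restrict_hom π S.ker fun a k hk => by
    rw [hK] at hk ⊢
    rw [hint, hk, map_zero]
  obtain ⟨τ, hτ⟩ := exists_factorization_of_unitary (C := S.ker →L[ℂ] S.ker) ι hιu hιv ρ (by
    refine (sub_eq_zero.1 ?_).symm
    ext k
    -- The coordinate of index `0` of `S k` is `e k`, so `ww* = 1` on the kernel.
    have h1 : (S k) 0 = 0 := by rw [(hK k).1 k.2]; rfl
    rw [hS, woldCoeff, pow_zero, mul_one] at h1
    simp only [← map_mul, ← map_star, ← map_one π, ← map_sub] at h1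
    simp only [← map_mul, ← map_star, ← map_one ρ, ← map_sub]
    rw [hρ, h1]
    rfl)
  ext y
  have hy : π x y ∈ S.ker := by rw [hK, hint, hx, map_zero]; rfl
  -- On `ker S` the operator `π (x*)` is `τ (ι x)* = 0`, and `π x y` lies in `ker S`. It remains to
  -- read off `‖π x y‖² = ⟨y, π(x*) π(x) y⟩ = 0`.
  have h1 : π (star x) (π x y) = 0 := by
    have := hρ (star x) ⟨π x y, hy⟩
    rw [← hτ, map_star, hx, star_zero, map_zero] at this
    exact this.symm
  rw [zero_apply, ← inner_self_eq_zero (𝕜 := ℂ), ← ContinuousLinearMap.adjoint_inner_right,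
    ← ContinuousLinearMap.star_eq_adjoint, ← map_star, h1, inner_zero_right]

end

/-! ### The embedding of the free twist -/

theorem mainTheorem6 (θ : ℝ) :
    ∃ ι : FreeTwist θ →⋆ₐ[ℂ] CStarTensor (ToeplitzCrossed θ) CircleFreeC2,
      ι (FreeTwist.u θ) =
          CStarTensor.tmul (ToeplitzCrossed.v θ * ToeplitzCrossed.u θ)
            (CircleFreeC2.u * CircleFreeC2.p) +
          CStarTensor.tmul (ToeplitzCrossed.u θ)
            (CircleFreeC2.u * (1 - CircleFreeC2.p)) ∧
      ι (FreeTwist.v θ) =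
          CStarTensor.tmul (star (ToeplitzCrossed.u θ) * ToeplitzCrossed.v θ)
            ((1 - CircleFreeC2.p) * star CircleFreeC2.u) +
          CStarTensor.tmul (star (ToeplitzCrossed.u θ))
            (CircleFreeC2.p * star CircleFreeC2.u) ∧
      Function.Injective ι := by
  obtain ⟨ι, hιu, hιv⟩ := FreeTwist.exists_lift (FreeTwist.isTwistedPair_tensor θ)
  refine ⟨ι, hιu, hιv, (injective_iff_map_eq_zero ι).2 fun x hx => ?_⟩
  by_contra hne
  obtain ⟨H, _, _, _, π, hπ⟩ := CStarAlgebra.exists_representation_ne_zero hne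
  exact hπ (FreeTwist.representation_eq_zero ι hιu hιv π hx)
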